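/- **Setting.** Let $K\in\{\mathbb R,\mathbb C\}$, let $(\Omega,\mathcal F,P)$ be a probability space, let $L^0(\mathcal F,K)$ be the algebra of $K$-valued random variables modulo a.s. equality, and $L^0_+(\mathcal F)=\{\xi\in L^0(\mathcal F,\mathbb R):\xi\ge 0\}$. A random normed (RN) module is an $L^0(\mathcal F,K)$-module $X$ with an $L^0$-norm $\|\cdot\|:X\to L^0_+(\mathcal F)$ satisfying $\|\xi x\|=|\xi|\,\|x\|$, $\|x+y\|\le\|x\|+\|y\|$, and $\|x\|=0\Rightarrow x=0$. It carries the $(\varepsilon,\lambda)$-topology, with neighbourhood base of $0$ given by $\{z: P(\|z\|<\varepsilon)>\lambda\}$, $\varepsilon>0$, $0<\lambda<1$. Limits, continuity, derivatives and Riemann integrals (limits of Riemann sums) of $X$-valued functions are taken in this topology; derivatives on $[0,\infty)$ are one-sided at $0$. Let $X$ be complete. $B(X)$ denotes the module homomorphisms $T:X\to X$ that are a.s. bounded, i.e. $\|Tz\|\le\eta\|z\|$ for all $z$ and some $\eta\in L^0_+(\mathcal F)$ (equivalently, continuous); $\|T\|$ is the infimum of such $\eta$. A family $\{V(s)\}_{s\ge0}\subseteq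 B(X)$ is locally a.s. bounded if $\bigvee_{s\in[0,l]}\|V(s)\|\in L^0_+(\mathcal F)$ for all $l>0$. A function $g:[0,\infty)\to X$ is locally $L^0$-Lipschitz if for each $l>0$ there is $\xi_l\in L^0_+(\mathcal F)$ with $\|g(s_1)-g(s_2)\|\le\xi_l|s_1-s_2|$ for all $s_1,s_2\in[0,l]$. For injective $C\in B(X)$, a family $\{V(s)\}_{s\ge0}\subseteq B(X)$ is a $C$-semigroup if $s\mapsto V(s)z$ is continuous for each $z\in X$, $V(0)=C$, and $CV(s+t)=V(s)V(t)$ for $s,t\ge0$. Its generator $(A,D(A))$ is given by $D(A)=\{z:\lim_{s\downarrow0}\frac{V(s)z-Cz}{s}\text{ exists and belongs to }C(X)\}$ and $Az=C^{-1}\lim_{s\downarrow0}\frac{V(s)z-Cz}{s}$. For a module homomorphism $A:D(A)\to X$ on a submodule $D(A)\subseteq X$, let $[D(A)]$ be $D(A)$ with the graph $L^0$-norm $\|z\|+\|Az\|$. Let $C\in B(X)$. * A *mild $C$-existence family* for $A$ is a locally a.s. bounded family $\{V(s)\}_{s\ge0}\subseteq B(X)$ such that for all $z\in X$ the map $s\mapsto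 V(s)z$ is continuous and, for all $s\ge0$, $\int_0^sV(u)z\,du\in D(A)$ and $A\int_0^sV(u)z\,du=V(s)z-Cz$. * A *$C$-existence family* for $A$ is a locally a.s. bounded family $\{V(s)\}_{s\ge0}\subseteq B([D(A)])$ such that for all $z\in D(A)$ the map $s\mapsto V(s)z\in[D(A)]$ is continuous and $\int_0^sAV(u)z\,du=V(s)z-Cz$ in $X$ for all $s\ge0$. * A *strong $C$-existence family* for $A$ is a mild $C$-existence family for $A$ such that each $V(s)$ maps $D(A)$ into $D(A)$ and the restrictions $V(s)|_{[D(A)]}$ form a $C$-existence family for $A$. For $z\in X$, a *solution* of the abstract Cauchy problem for $A$ with initial value $z$ is a $W\in C([0,\infty),[D(A)])\cap C^1([0,\infty),X)$ with $W'(s)=AW(s)$ for $s>0$ and $W(0)=z$. A *mild solution* is a $W\in C([0,\infty),X)$ such that, for every $s\ge0$, $\bigvee_{u\in[0,s]}\|W(u)\|\in L^0_+(\mathcal F)$, $\int_0^sW(u)\,du\in D(A)$ and $W(s)=A\int_0^sW(u)\,du+z$. **Theorem.** (a) Let $\{V(s)\}_{s\ge0}$ be a locally a.s. bounded $C$-semigroup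 on $X$ with generator $(A,D(A))$. Then $\{V(s)\}_{s\ge0}$ is a strong $C$-existence family for $(A,D(A))$. (b) Let $A:D(A)\to X$ be a module homomorphism such that some extension of $(A,D(A))$ is the generator of a locally a.s. bounded $C$-semigroup on $X$, and let $z\in X$. Then any two locally $L^0$-Lipschitz solutions of the abstract Cauchy problem for $A$ with initial value $z$ coincide, and any two locally $L^0$-Lipschitz mild solutions of it coincide. -/

import Mathlib

open MeasureTheory Filter Topology
open scoped NNReal

/-- `L⁰(F, R)`, the classes of `R`-valued random variables modulo `P`-almost sure equality,
is a commutative ring under the pointwise operations. -/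
noncomputable instance MeasureTheory.AEEqFun.instCommRingL0 {Ω : Type*} [MeasurableSpace Ω]
    {P : Measure Ω} {R : Type*} [TopologicalSpace R] [CommRing R] [IsTopologicalRing R] :
    CommRing (Ω →ₘ[P] R) where
  __ := AEEqFun.instAddCommGroup (α := Ω) (μ := P) (γ := R)
  __ := AEEqFun.instCommMonoid (α := Ω) (μ := P) (γ := R)
  left_distrib f g h := by
    apply AEEqFun.ext
    filter_upwards [AEEqFun.coeFn_mul f (g + h), AEEqFun.coeFn_add g h,
      AEEqFun.coeFn_add (f * g) (f * h), AEEqFun.coeFn_mul f g, AEEqFun.coeFn_mul f h]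
      with ω h1 h2 h3 h4 h5
    simp only [h1, h2, h3, h4, h5, Pi.mul_apply, Pi.add_apply, mul_add]
  right_distrib f g h := by
    apply AEEqFun.ext
    filter_upwards [AEEqFun.coeFn_mul (f + g) h, AEEqFun.coeFn_add f g,
      AEEqFun.coeFn_add (f * h) (g * h), AEEqFun.coeFn_mul f h, AEEqFun.coeFn_mul g h]
      with ω h1 h2 h3 h4 h5
    simp only [h1, h2, h3, h4, h5, Pi.mul_apply, Pi.add_apply, add_mul]
  zero_mul f := by
    apply AEEqFun.ext
    filter_upwards [AEEqFun.coeFn_mul 0 f, AEEqFun.coeFn_zero (α := Ω) (μ := P) (β := R)]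
      with ω h1 h2
    simp only [h1, h2, Pi.mul_apply, Pi.zero_apply, zero_mul]
  mul_zero f := by
    apply AEEqFun.ext
    filter_upwards [AEEqFun.coeFn_mul f 0, AEEqFun.coeFn_zero (α := Ω) (μ := P) (β := R)]
      with ω h1 h2
    simp only [h1, h2, Pi.mul_apply, Pi.zero_apply, mul_zero]

/-- The modulus `|ξ| ∈ L⁰₊(F)` of a scalar random variable `ξ ∈ L⁰(F, 𝕜)`. -/
noncomputable def absL0 {𝕜 : Type*} [RCLike 𝕜] {Ω : Type*} [MeasurableSpace Ω] {P : Measure Ω}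
    (ξ : Ω →ₘ[P] 𝕜) : Ω →ₘ[P] ℝ :=
  AEEqFun.comp (fun x : 𝕜 => ‖x‖) continuous_norm ξ

/-- An `L⁰`-norm on an `L⁰(F, 𝕜)`-module `X`. The pair of `X` and such a norm is a
random normed (RN) module over `𝕜` with base `(Ω, F, P)`. -/
structure L0Norm (𝕜 : Type*) [RCLike 𝕜] {Ω : Type*} [MeasurableSpace Ω] (P : Measure Ω)
    (X : Type*) [AddCommGroup X] [Module (Ω →ₘ[P] 𝕜) X] where
  /-- the norm function -/
  toFun : X → (Ω →ₘ[P] ℝ)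
  nonneg : ∀ x, 0 ≤ toFun x
  map_smul : ∀ (ξ : Ω →ₘ[P] 𝕜) (x : X), toFun (ξ • x) = absL0 ξ * toFun x
  add_le : ∀ x y, toFun (x + y) ≤ toFun x + toFun y
  eq_zero_of_map_eq_zero : ∀ x, toFun x = 0 → x = 0

namespace L0Norm

section

variable {𝕜 : Type*} [RCLike 𝕜] {Ω : Type*} [MeasurableSpace Ω] {P : Measure Ω}
  {X : Type*} [AddCommGroup X] [Module (Ω →ₘ[P] 𝕜) X]

instance : CoeFun (L0Norm 𝕜 P X) (fun _ => X → (Ω →ₘ[P] ℝ)) := ⟨L0Norm.toFun⟩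

/-- Multiplication of an element of `X` by a real number, through the constant random variables. -/
noncomputable def rsmul (_N : L0Norm 𝕜 P X) (r : ℝ) (x : X) : X :=
  (AEEqFun.const Ω (r : 𝕜) : Ω →ₘ[P] 𝕜) • x

/-! ### The `(ε, lam)`-topology -/

/-- The basic neighbourhood `U(ε, lam) = {z | P{ω | ‖z‖(ω) < ε} > lam}` of the null element. -/
def basicNhd (N : L0Norm 𝕜 P X) (ε lam : ℝ) : Set X :=
  {z | lam < P.real {ω | (N z : Ω → ℝ) ω < ε}}

theorem basicNhd_mono (N : L0Norm 𝕜 P X) [IsProbabilityMeasure P] {ε ε' lam lam' : ℝ}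
    (h : ε ≤ ε') (h' : lam' ≤ lam) : N.basicNhd ε lam ⊆ N.basicNhd ε' lam' := by
  intro z hz
  refine h'.trans_lt (hz.trans_le (measureReal_mono ?_))
  intro ω hω
  exact lt_of_lt_of_le hω h

/-- The `(ε, lam)`-topology: the sets `x + U(ε, lam)`, with `ε > 0` and `0 < lam < 1`,
form a neighbourhood base at `x`. -/
@[reducible]
def topology (N : L0Norm 𝕜 P X) [IsProbabilityMeasure P] : TopologicalSpace X where
  IsOpen S := ∀ x ∈ S, ∃ ε > 0, ∃ lam ∈ Set.Ioo (0 : ℝ) 1, ∀ y, y - x ∈ N.basicNhd ε lam → y ∈ S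
  isOpen_univ := fun _ _ => ⟨1, one_pos, 1 / 2, by norm_num, fun _ _ => trivial⟩
  isOpen_inter := by
    rintro S T hS hT x ⟨hxS, hxT⟩
    obtain ⟨ε, hε, lam, hlam, h⟩ := hS x hxS
    obtain ⟨ε', hε', lam', hlam', h'⟩ := hT x hxT
    refine ⟨min ε ε', lt_min hε hε', max lam lam',
      ⟨lt_max_of_lt_left hlam.1, max_lt hlam.2 hlam'.2⟩, fun y hy => ⟨h y ?_, h' y ?_⟩⟩
    · exact N.basicNhd_mono (min_le_left _ _) (le_max_left _ _) hy
    · exact N.basicNhd_mono (min_le_right _ _) (le_max_right _ _) hy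
  isOpen_sUnion := by
    rintro 𝒮 h𝒮 x ⟨S, hS, hx⟩
    obtain ⟨ε, hε, lam, hlam, h⟩ := h𝒮 S hS x hx
    exact ⟨ε, hε, lam, hlam, fun y hy => ⟨S, hS, h y hy⟩⟩

/-- Convergence in the `(ε, lam)`-topology. -/
def TendsTo (N : L0Norm 𝕜 P X) [IsProbabilityMeasure P] {ι : Type*} (f : ι → X) (l : Filter ι)
    (x : X) : Prop :=
  Tendsto f l (@nhds X N.topology x)

/-- Continuity of a function `[0, ∞) → X` for the `(ε, lam)`-topology. -/
def IsCont (N : L0Norm 𝕜 P X) [IsProbabilityMeasure P] (f : ℝ≥0 → X) : Prop :=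
  @Continuous ℝ≥0 X _ N.topology f

/-- Completeness of the RN module for the (metrizable, linear) `(ε, lam)`-topology:
every Cauchy sequence converges. -/
def IsComplete (N : L0Norm 𝕜 P X) [IsProbabilityMeasure P] : Prop :=
  ∀ z : ℕ → X,
    (∀ ε > 0, ∀ lam ∈ Set.Ioo (0 : ℝ) 1, ∃ n₀, ∀ m ≥ n₀, ∀ n ≥ n₀,
      z m - z n ∈ N.basicNhd ε lam) →
    ∃ x, N.TendsTo z atTop x

theorem add_mem_basicNhd (N : L0Norm 𝕜 P X) [IsProbabilityMeasure P] {ε lam : ℝ} {x y : X}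
    (hx : x ∈ N.basicNhd (ε / 2) ((1 + lam) / 2)) (hy : y ∈ N.basicNhd (ε / 2) ((1 + lam) / 2)) :
    x + y ∈ N.basicNhd ε lam := by
  simp only [basicNhd, Set.mem_ofPred_eq] at hx hy ⊢
  have hmy : MeasurableSet {ω | (N y : Ω → ℝ) ω < ε / 2} :=
    measurableSet_lt (N y).measurable measurable_const
  have h1 := measureReal_union_add_inter (μ := P) (s := {ω | (N x : Ω → ℝ) ω < ε / 2}) hmy
  have h2 : P.real ({ω | (N x : Ω → ℝ) ω < ε / 2} ∪ {ω | (N y : Ω → ℝ) ω < ε / 2}) ≤ 1 :=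
    measureReal_le_one
  have h3 : P.real ({ω | (N x : Ω → ℝ) ω < ε / 2} ∩ {ω | (N y : Ω → ℝ) ω < ε / 2}) ≤
      P.real {ω | (N (x + y) : Ω → ℝ) ω < ε} := by
    refine ENNReal.toReal_mono (measure_ne_top _ _) (measure_mono_ae ?_)
    filter_upwards [AEEqFun.coeFn_le.2 (N.add_le x y), AEEqFun.coeFn_add (N x) (N y)]
      with ω ha hb hω
    rw [hb] at ha
    have hω1 : (N x : Ω → ℝ) ω < ε / 2 := hω.1
    have hω2 : (N y : Ω → ℝ) ω < ε / 2 := hω.2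
    change (N (x + y) : Ω → ℝ) ω < ε
    have ha' : (N (x + y) : Ω → ℝ) ω ≤ (N x : Ω → ℝ) ω + (N y : Ω → ℝ) ω := ha
    linarith
  linarith

theorem smul_mem_basicNhd (N : L0Norm 𝕜 P X) [IsProbabilityMeasure P] (ξ : Ω →ₘ[P] 𝕜)
    {ε lam : ℝ} (hε : 0 < ε) (hlam : lam ∈ Set.Ioo (0 : ℝ) 1) :
    ∃ δ > 0, ∃ lam' ∈ Set.Ioo (0 : ℝ) 1, ∀ x ∈ N.basicNhd δ lam', ξ • x ∈ N.basicNhd ε lam := by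
  have hmeas : ∀ c : ℝ, MeasurableSet {ω | (absL0 ξ : Ω → ℝ) ω < c} := fun c =>
    measurableSet_lt (absL0 ξ).measurable measurable_const
  have hmono : Monotone (fun n : ℕ => {ω | (absL0 ξ : Ω → ℝ) ω < (n : ℝ)}) := by
    intro m n hmn ω hω
    have : (m : ℝ) ≤ n := by exact_mod_cast hmn
    exact lt_of_lt_of_le (show (absL0 ξ : Ω → ℝ) ω < m from hω) this
  have hU : (⋃ n : ℕ, {ω | (absL0 ξ : Ω → ℝ) ω < (n : ℝ)}) = Set.univ := by
    ext ω
    simp only [Set.mem_iUnion, Set.mem_ofPred_eq, Set.mem_univ, iff_true]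
    exact exists_nat_gt _
  have ht : Tendsto (fun n : ℕ => P.real {ω | (absL0 ξ : Ω → ℝ) ω < (n : ℝ)}) atTop (𝓝 1) := by
    have := tendsto_measure_iUnion_atTop (μ := P) hmono
    rw [hU, measure_univ] at this
    exact (ENNReal.tendsto_toReal ENNReal.one_ne_top).comp this
  have hlt : (1 + lam) / 2 < 1 := by linarith [hlam.2]
  obtain ⟨n, hn, hn1⟩ := ((ht.eventually (lt_mem_nhds hlt)).and (eventually_ge_atTop 1)).exists
  have hn0 : (0 : ℝ) < n := by exact_mod_cast hn1
  refine ⟨ε / n, by positivity, (1 + lam) / 2, ⟨by linarith [hlam.1], hlt⟩, fun x hx => ?_⟩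
  simp only [basicNhd, Set.mem_ofPred_eq] at hx ⊢
  have h1 := measureReal_union_add_inter (μ := P) (s := {ω | (N x : Ω → ℝ) ω < ε / n}) (hmeas n)
  have h2 : P.real ({ω | (N x : Ω → ℝ) ω < ε / n} ∪ {ω | (absL0 ξ : Ω → ℝ) ω < (n : ℝ)}) ≤ 1 :=
    measureReal_le_one
  have h3 : P.real ({ω | (N x : Ω → ℝ) ω < ε / n} ∩ {ω | (absL0 ξ : Ω → ℝ) ω < (n : ℝ)}) ≤
      P.real {ω | (N (ξ • x) : Ω → ℝ) ω < ε} := by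
    refine ENNReal.toReal_mono (measure_ne_top _ _) (measure_mono_ae ?_)
    rw [N.map_smul]
    filter_upwards [AEEqFun.coeFn_mul (absL0 ξ) (N x), AEEqFun.coeFn_le.2 (N.nonneg x),
      AEEqFun.coeFn_zero (α := Ω) (μ := P) (β := ℝ)] with ω ha hb hc hω
    rw [hc] at hb
    have hb' : 0 ≤ (N x : Ω → ℝ) ω := hb
    have hω1 : (N x : Ω → ℝ) ω < ε / n := hω.1
    have hω2 : (absL0 ξ : Ω → ℝ) ω < n := hω.2
    change (absL0 ξ * N x : Ω →ₘ[P] ℝ) ω < ε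
    rw [ha, Pi.mul_apply]
    rw [lt_div_iff₀ hn0] at hω1
    nlinarith
  linarith

theorem zero_mem_basicNhd (N : L0Norm 𝕜 P X) [IsProbabilityMeasure P] {ε lam : ℝ} (hε : 0 < ε)
    (hlam : lam < 1) : (0 : X) ∈ N.basicNhd ε lam := by
  have h0 : N (0 : X) = 0 := by
    have h := N.map_smul 0 0
    rw [zero_smul (Ω →ₘ[P] 𝕜) (0 : X)] at h
    rw [h]
    have : absL0 (0 : Ω →ₘ[P] 𝕜) = 0 := by
      apply AEEqFun.ext
      filter_upwards [AEEqFun.coeFn_comp (fun x : 𝕜 => ‖x‖) continuous_norm (0 : Ω →ₘ[P] 𝕜),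
        AEEqFun.coeFn_zero (α := Ω) (μ := P) (β := 𝕜),
        AEEqFun.coeFn_zero (α := Ω) (μ := P) (β := ℝ)] with ω h1 h2 h3
      rw [absL0, h1, h3, Function.comp_apply, h2]
      simp
    rw [this, zero_mul]
  simp only [basicNhd, Set.mem_ofPred_eq, h0]
  refine hlam.trans_le ?_
  have h1 : P {ω | ((0 : Ω →ₘ[P] ℝ) : Ω → ℝ) ω < ε} = 1 := by
    rw [← measure_univ (μ := P)]
    refine measure_congr ?_
    filter_upwards [AEEqFun.coeFn_zero (α := Ω) (μ := P) (β := ℝ)] with ω h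
    refine propext ⟨fun _ => trivial, fun _ => ?_⟩
    change ((0 : Ω →ₘ[P] ℝ) : Ω → ℝ) ω < ε
    rw [h]
    exact hε
  rw [Measure.real, h1, ENNReal.toReal_one]

/-- The sets `x + U(ε, lam)` do form a neighbourhood base at `x`. -/
theorem mem_nhds_iff (N : L0Norm 𝕜 P X) [IsProbabilityMeasure P] {x : X} {S : Set X} :
    S ∈ @nhds X N.topology x ↔
      ∃ ε > 0, ∃ lam ∈ Set.Ioo (0 : ℝ) 1, ∀ y, y - x ∈ N.basicNhd ε lam → y ∈ S := by
  let := N.topology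
  constructor
  · intro h
    obtain ⟨T, hTS, hT, hx⟩ := _root_.mem_nhds_iff.1 h
    obtain ⟨ε, hε, lam, hlam, hU⟩ := hT x hx
    exact ⟨ε, hε, lam, hlam, fun y hy => hTS (hU y hy)⟩
  · rintro ⟨ε, hε, lam, hlam, hU⟩
    refine _root_.mem_nhds_iff.2 ⟨{w | ∃ ε > 0, ∃ lam ∈ Set.Ioo (0 : ℝ) 1,
      ∀ y, y - w ∈ N.basicNhd ε lam → y ∈ S}, ?_, ?_, ⟨ε, hε, lam, hlam, hU⟩⟩
    · rintro w ⟨ε, hε, lam, hlam, h⟩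
      exact h w (by rw [sub_self]; exact N.zero_mem_basicNhd hε hlam.2)
    · rintro w ⟨ε, hε, lam, hlam, h⟩
      have hl : (1 + lam) / 2 ∈ Set.Ioo (0 : ℝ) 1 :=
        ⟨by linarith [hlam.1], by linarith [hlam.2]⟩
      refine ⟨ε / 2, by positivity, (1 + lam) / 2, hl, fun y hy =>
        ⟨ε / 2, by positivity, (1 + lam) / 2, hl, fun v hv => h v ?_⟩⟩
      have := N.add_mem_basicNhd hv hy
      rwa [sub_add_sub_cancel] at this

theorem tendsTo_iff (N : L0Norm 𝕜 P X) [IsProbabilityMeasure P] {ι : Type*} {f : ι → X}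
    {l : Filter ι} {x : X} :
    N.TendsTo f l x ↔
      ∀ ε > 0, ∀ lam ∈ Set.Ioo (0 : ℝ) 1, ∀ᶠ i in l, f i - x ∈ N.basicNhd ε lam := by
  constructor
  · intro h ε hε lam hlam
    exact h (N.mem_nhds_iff.2 ⟨ε, hε, lam, hlam, fun y hy => hy⟩)
  · intro h S hS
    obtain ⟨ε, hε, lam, hlam, hU⟩ := N.mem_nhds_iff.1 hS
    exact mem_map.2 ((h ε hε lam hlam).mono fun i hi => hU _ hi)

theorem TendsTo.add {N : L0Norm 𝕜 P X} [IsProbabilityMeasure P] {ι : Type*} {f g : ι → X}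
    {l : Filter ι} {x y : X} (hf : N.TendsTo f l x) (hg : N.TendsTo g l y) :
    N.TendsTo (fun i => f i + g i) l (x + y) := by
  rw [tendsTo_iff] at *
  intro ε hε lam hlam
  have hl : (1 + lam) / 2 ∈ Set.Ioo (0 : ℝ) 1 := ⟨by linarith [hlam.1], by linarith [hlam.2]⟩
  filter_upwards [hf (ε / 2) (by positivity) _ hl, hg (ε / 2) (by positivity) _ hl] with i h1 h2
  have := N.add_mem_basicNhd h1 h2
  rwa [show f i - x + (g i - y) = f i + g i - (x + y) by abel] at this

theorem TendsTo.smul {N : L0Norm 𝕜 P X} [IsProbabilityMeasure P] {ι : Type*} {f : ι → X}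
    {l : Filter ι} {x : X} (ξ : Ω →ₘ[P] 𝕜) (hf : N.TendsTo f l x) :
    N.TendsTo (fun i => ξ • f i) l (ξ • x) := by
  rw [tendsTo_iff] at *
  intro ε hε lam hlam
  obtain ⟨δ, hδ, lam', hlam', h⟩ := N.smul_mem_basicNhd ξ hε hlam
  filter_upwards [hf δ hδ lam' hlam'] with i hi
  rw [← smul_sub]
  exact h _ hi

theorem tendsTo_const (N : L0Norm 𝕜 P X) [IsProbabilityMeasure P] {ι : Type*} {l : Filter ι}
    (x : X) : N.TendsTo (fun _ => x) l x :=
  letI := N.topology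
  tendsto_const_nhds

/-- The topology is Hausdorff on sequences and nets: limits are unique. -/
theorem TendsTo.unique {N : L0Norm 𝕜 P X} [IsProbabilityMeasure P] {ι : Type*} {f : ι → X}
    {l : Filter ι} [l.NeBot] {x y : X} (hx : N.TendsTo f l x) (hy : N.TendsTo f l y) : x = y := by
  have h := hx.add (hy.smul (-1))
  have hmem : ∀ ε > 0, ∀ lam ∈ Set.Ioo (0 : ℝ) 1, x - y ∈ N.basicNhd ε lam := by
    intro ε hε lam hlam
    obtain ⟨δ, hδ, lam', hlam', hs⟩ := N.smul_mem_basicNhd (-1) hε hlam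
    obtain ⟨i, hi⟩ := ((N.tendsTo_iff.1 h) δ hδ lam' hlam').exists
    have := hs _ hi
    simpa [sub_eq_add_neg, add_comm] using this
  rw [← sub_eq_zero]
  apply N.eq_zero_of_map_eq_zero
  have hle : ∀ n : ℕ, ∀ᵐ ω ∂P, (N (x - y) : Ω → ℝ) ω < 1 / ((n : ℝ) + 1) := by
    intro n
    have hn : (0 : ℝ) < 1 / ((n : ℝ) + 1) := by positivity
    have h1 : P.real {ω | (N (x - y) : Ω → ℝ) ω < 1 / ((n : ℝ) + 1)} = 1 := by
      refine le_antisymm measureReal_le_one (le_of_forall_lt fun c hc => ?_)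
      have hc' : max c (1 / 2) ∈ Set.Ioo (0 : ℝ) 1 :=
        ⟨lt_max_of_lt_right (by norm_num), max_lt hc (by norm_num)⟩
      exact lt_of_le_of_lt (le_max_left _ _) (hmem _ hn _ hc')
    have hm : MeasurableSet {ω | (N (x - y) : Ω → ℝ) ω < 1 / ((n : ℝ) + 1)} :=
      measurableSet_lt (N (x - y)).measurable measurable_const
    have h2 : P {ω | (N (x - y) : Ω → ℝ) ω < 1 / ((n : ℝ) + 1)} = 1 := by
      rw [← ENNReal.toReal_eq_one_iff]
      exact h1
    exact (prob_compl_eq_zero_iff hm).2 h2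
  apply AEEqFun.ext
  filter_upwards [ae_all_iff.2 hle, AEEqFun.coeFn_le.2 (N.nonneg (x - y)),
    AEEqFun.coeFn_zero (α := Ω) (μ := P) (β := ℝ)] with ω h1 h2 h3
  rw [h3] at h2 ⊢
  refine le_antisymm (ge_of_tendsto' tendsto_one_div_add_atTop_nhds_zero_nat fun n => (h1 n).le) h2

/-! ### Calculus in an RN module -/

/-- `y` is the Riemann integral of `f : [0, ∞) → X` over `[a, b]`: the Riemann sums over tagged
partitions `a = t 0 ≤ t 1 ≤ ⋯ ≤ t n = b` with tags `τ i ∈ [t i, t (i + 1)]` converge to `y` in the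
`(ε, lam)`-topology as the mesh tends to zero. -/
def HasRiemannIntegral (N : L0Norm 𝕜 P X) (f : ℝ≥0 → X) (a b : ℝ≥0) (y : X) : Prop :=
  ∀ ε > 0, ∀ lam ∈ Set.Ioo (0 : ℝ) 1, ∃ δ > (0 : ℝ), ∀ (n : ℕ) (t τ : ℕ → ℝ≥0),
    t 0 = a → t n = b →
    (∀ i < n, t i ≤ τ i ∧ τ i ≤ t (i + 1) ∧ (t (i + 1) : ℝ) - t i < δ) →
    (∑ i ∈ Finset.range n, N.rsmul ((t (i + 1) : ℝ) - t i) (f (τ i))) - y ∈ N.basicNhd ε lam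

/-- `f : [0, ∞) → X` has derivative `y` at `s` in the `(ε, lam)`-topology (two-sided for `s > 0`,
from the right at `s = 0`). -/
def HasDeriv (N : L0Norm 𝕜 P X) [IsProbabilityMeasure P] (f : ℝ≥0 → X) (y : X) (s : ℝ≥0) : Prop :=
  N.TendsTo (fun t : ℝ≥0 => N.rsmul ((t : ℝ) - s)⁻¹ (f t - f s)) (𝓝[≠] s) y

/-- `f ∈ C¹([0, ∞), X)`. -/
def IsC1 (N : L0Norm 𝕜 P X) [IsProbabilityMeasure P] (f : ℝ≥0 → X) : Prop :=
  ∃ f' : ℝ≥0 → X, (∀ s, N.HasDeriv f (f' s) s) ∧ N.IsCont f'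

/-- `g : [0, ∞) → X` is locally `L⁰`-Lipschitz. -/
def LocallyL0Lipschitz (N : L0Norm 𝕜 P X) (g : ℝ≥0 → X) : Prop :=
  ∀ l : ℝ≥0, 0 < l → ∃ ξ : Ω →ₘ[P] ℝ, 0 ≤ ξ ∧ ∀ s₁ ∈ Set.Icc 0 l, ∀ s₂ ∈ Set.Icc 0 l,
    N (g s₁ - g s₂) ≤ |(s₁ : ℝ) - s₂| • ξ

/-! ### Almost surely bounded operators -/

/-- The set of all `η ∈ L⁰₊(F)` with `‖T z‖ ≤ η ‖z‖` for all `z`, whose infimum in `L⁰(F, ℝ)`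
is the `L⁰`-norm `‖T‖` when it is nonempty. -/
def bounds (N : L0Norm 𝕜 P X) (T : X →ₗ[Ω →ₘ[P] 𝕜] X) : Set (Ω →ₘ[P] ℝ) :=
  {η | 0 ≤ η ∧ ∀ z, N (T z) ≤ η * N z}

/-- `T ∈ B(X)`: the module homomorphism `T` is a.s. bounded (equivalently, continuous). -/
def IsASBounded (N : L0Norm 𝕜 P X) (T : X →ₗ[Ω →ₘ[P] 𝕜] X) : Prop :=
  (N.bounds T).Nonempty

/-- The family `V(s) ∈ B(X)`, `s ≥ 0`, is locally a.s. bounded: for each `l > 0` the norms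
`‖V(s)‖`, `s ∈ [0, l]`, have an upper bound in `L⁰₊(F)`, i.e. their supremum is in `L⁰₊(F)`.
(An `η ∈ L⁰₊(F)` is at least `‖T‖` exactly when it lies in `bounds T`.) -/
def LocallyASBounded (N : L0Norm 𝕜 P X) (V : ℝ≥0 → X →ₗ[Ω →ₘ[P] 𝕜] X) : Prop :=
  ∀ l : ℝ≥0, 0 < l → ∃ η : Ω →ₘ[P] ℝ, ∀ s ∈ Set.Icc 0 l, η ∈ N.bounds (V s)

/-! ### `C`-semigroups and their generators -/

/-- `{V(s) : s ≥ 0} ⊆ B(X)` is a `C`-semigroup on `X`, where `C ∈ B(X)` is injective. -/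
structure IsCSemigroup (N : L0Norm 𝕜 P X) [IsProbabilityMeasure P] (C : X →ₗ[Ω →ₘ[P] 𝕜] X)
    (V : ℝ≥0 → X →ₗ[Ω →ₘ[P] 𝕜] X) : Prop where
  bounded_C : N.IsASBounded C
  injective_C : Function.Injective C
  bounded : ∀ s, N.IsASBounded (V s)
  cont : ∀ z, N.IsCont (fun s => V s z)
  map_zero : V 0 = C
  map_add : ∀ s t z, C (V (s + t) z) = V s (V t z)

/-- The graph of the generator: the pairs `(z, y)` with `(V(s) z - C z) / s → C y` as `s ↓ 0`. -/
noncomputable def generatorGraph (N : L0Norm 𝕜 P X) [IsProbabilityMeasure P]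
    (C : X →ₗ[Ω →ₘ[P] 𝕜] X) (V : ℝ≥0 → X →ₗ[Ω →ₘ[P] 𝕜] X) :
    Submodule (Ω →ₘ[P] 𝕜) (X × X) where
  carrier := {p | N.TendsTo (fun s : ℝ≥0 => N.rsmul (s : ℝ)⁻¹ (V s p.1 - C p.1))
    (𝓝[>] 0) (C p.2)}
  zero_mem' := by
    simpa [rsmul] using N.tendsTo_const (l := 𝓝[>] (0 : ℝ≥0)) (0 : X)
  add_mem' := by
    intro p q hp hq
    have h := TendsTo.add hp hq
    simp only [Set.mem_ofPred_eq, Prod.fst_add, Prod.snd_add, _root_.map_add]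
    refine h.congr fun s => ?_
    simp only [rsmul]
    rw [← smul_add]
    congr 1
    abel
  smul_mem' := by
    intro ξ p hp
    have h := TendsTo.smul ξ hp
    simp only [Set.mem_ofPred_eq, Prod.smul_fst, Prod.smul_snd, _root_.map_smul]
    refine h.congr fun s => ?_
    simp only [rsmul]
    rw [smul_comm, smul_sub ξ]

/-- The generator `(A, D(A))`: `D(A)` is the set of all `z` for which the limit of
`(V(s) z - C z) / s` as `s ↓ 0` exists and belongs to the range of `C`, and `A z` is the preimage
of that limit under `C`. -/
noncomputable def generator (N : L0Norm 𝕜 P X) [IsProbabilityMeasure P]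
    (C : X →ₗ[Ω →ₘ[P] 𝕜] X) (V : ℝ≥0 → X →ₗ[Ω →ₘ[P] 𝕜] X) : X →ₗ.[Ω →ₘ[P] 𝕜] X :=
  (N.generatorGraph C V).toLinearPMap

/-- For injective `C` the generator is the operator with graph `generatorGraph`. -/
theorem mem_graph_generator (N : L0Norm 𝕜 P X) [IsProbabilityMeasure P]
    {C : X →ₗ[Ω →ₘ[P] 𝕜] X} (hC : Function.Injective C) (V : ℝ≥0 → X →ₗ[Ω →ₘ[P] 𝕜] X)
    (z y : X) :
    (z, y) ∈ (N.generator C V).graph ↔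
      N.TendsTo (fun s : ℝ≥0 => N.rsmul (s : ℝ)⁻¹ (V s z - C z)) (𝓝[>] 0) (C y) := by
  rw [generator, Submodule.toLinearPMap_graph_eq]
  · rfl
  · rintro ⟨z, y⟩ h (hz : z = 0)
    subst hz
    have h1 : N.TendsTo (fun s : ℝ≥0 => N.rsmul (s : ℝ)⁻¹ (V s 0 - C 0)) (𝓝[>] 0) (C y) := h
    have h2 : N.TendsTo (fun s : ℝ≥0 => N.rsmul (s : ℝ)⁻¹ (V s 0 - C 0)) (𝓝[>] 0) (0 : X) := by
      simpa [rsmul] using N.tendsTo_const (l := 𝓝[>] (0 : ℝ≥0)) (0 : X)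
    exact hC ((h1.unique h2).trans (_root_.map_zero C).symm)

/-! ### `C`-existence families and the abstract Cauchy problem -/

/-- The graph `L⁰`-norm `‖z‖ + ‖A z‖` on `D(A)`; this makes `D(A)` the RN module `[D(A)]`. -/
noncomputable def graphNorm (N : L0Norm 𝕜 P X) (A : X →ₗ.[Ω →ₘ[P] 𝕜] X) :
    L0Norm 𝕜 P A.domain where
  toFun z := N (z : X) + N (A z)
  nonneg z := by
    rw [← AEEqFun.coeFn_le]
    filter_upwards [AEEqFun.coeFn_le.2 (N.nonneg (z : X)), AEEqFun.coeFn_le.2 (N.nonneg (A z)),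
      AEEqFun.coeFn_add (N (z : X)) (N (A z)),
      AEEqFun.coeFn_zero (α := Ω) (μ := P) (β := ℝ)] with ω h1 h2 h3 h4
    rw [h4] at h1 h2
    rw [h3, h4]
    exact add_nonneg h1 h2
  map_smul ξ z := by
    rw [LinearPMap.map_smul, Submodule.coe_smul, N.map_smul, N.map_smul, mul_add]
  add_le z w := by
    rw [LinearPMap.map_add, Submodule.coe_add, ← AEEqFun.coeFn_le]
    filter_upwards [AEEqFun.coeFn_le.2 (N.add_le (z : X) w),
      AEEqFun.coeFn_le.2 (N.add_le (A z) (A w)),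
      AEEqFun.coeFn_add (N ((z : X) + w)) (N (A z + A w)),
      AEEqFun.coeFn_add (N (z : X)) (N (w : X)), AEEqFun.coeFn_add (N (A z)) (N (A w)),
      AEEqFun.coeFn_add (N (z : X) + N (A z)) (N (w : X) + N (A w)),
      AEEqFun.coeFn_add (N (z : X)) (N (A z)), AEEqFun.coeFn_add (N (w : X)) (N (A w))]
      with ω h1 h2 h3 h4 h5 h6 h7 h8
    rw [h4] at h1
    rw [h5] at h2
    rw [h3, h6]
    simp only [Pi.add_apply, h7, h8] at h1 h2 ⊢
    linarith
  eq_zero_of_map_eq_zero z h := by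
    have : N (z : X) = 0 := by
      apply AEEqFun.ext
      filter_upwards [AEEqFun.coeFn_le.2 (N.nonneg (z : X)), AEEqFun.coeFn_le.2 (N.nonneg (A z)),
        AEEqFun.coeFn_add (N (z : X)) (N (A z)),
        AEEqFun.coeFn_zero (α := Ω) (μ := P) (β := ℝ)] with ω h1 h2 h3 h4
      rw [h, h4] at h3
      rw [h4] at h1 h2 ⊢
      simp only [Pi.add_apply, Pi.zero_apply] at h1 h2 h3 ⊢
      linarith
    exact Subtype.ext (N.eq_zero_of_map_eq_zero _ this)

/-- `{V(s) : s ≥ 0} ⊆ B(X)` is a mild `C`-existence family for `A`. -/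
structure IsMildExistenceFamily (N : L0Norm 𝕜 P X) [IsProbabilityMeasure P]
    (A : X →ₗ.[Ω →ₘ[P] 𝕜] X) (C : X →ₗ[Ω →ₘ[P] 𝕜] X) (V : ℝ≥0 → X →ₗ[Ω →ₘ[P] 𝕜] X) : Prop where
  bounded_C : N.IsASBounded C
  locallyASBounded : N.LocallyASBounded V
  cont : ∀ z, N.IsCont (fun s => V s z)
  integral : ∀ (z : X) (s : ℝ≥0), ∃ y : A.domain,
    N.HasRiemannIntegral (fun u => V u z) 0 s (y : X) ∧ A y = V s z - C z

/-- `{V(s) : s ≥ 0} ⊆ B([D(A)])` is a `C`-existence family for `A`. -/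
structure IsExistenceFamily (N : L0Norm 𝕜 P X) [IsProbabilityMeasure P]
    (A : X →ₗ.[Ω →ₘ[P] 𝕜] X) (C : X →ₗ[Ω →ₘ[P] 𝕜] X)
    (V : ℝ≥0 → A.domain →ₗ[Ω →ₘ[P] 𝕜] A.domain) : Prop where
  bounded_C : N.IsASBounded C
  locallyASBounded : (N.graphNorm A).LocallyASBounded V
  cont : ∀ z, (N.graphNorm A).IsCont (fun s => V s z)
  integral : ∀ (z : A.domain) (s : ℝ≥0),
    N.HasRiemannIntegral (fun u => A (V u z)) 0 s ((V s z : X) - C z)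

/-- `{V(s) : s ≥ 0}` is a strong `C`-existence family for `A`: a mild `C`-existence family whose
restrictions to `D(A)` form a `C`-existence family for `A`. -/
def IsStrongExistenceFamily (N : L0Norm 𝕜 P X) [IsProbabilityMeasure P]
    (A : X →ₗ.[Ω →ₘ[P] 𝕜] X) (C : X →ₗ[Ω →ₘ[P] 𝕜] X) (V : ℝ≥0 → X →ₗ[Ω →ₘ[P] 𝕜] X) : Prop :=
  N.IsMildExistenceFamily A C V ∧
    ∃ h : ∀ s, ∀ z ∈ A.domain, V s z ∈ A.domain,
      N.IsExistenceFamily A C (fun s => (V s).restrict (h s))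

/-- `W` is a solution of the abstract Cauchy problem `W' = A W` on `(0, ∞)`, `W(0) = z`:
`W ∈ C([0, ∞), [D(A)]) ∩ C¹([0, ∞), X)` and the equations hold. -/
structure IsSolution (N : L0Norm 𝕜 P X) [IsProbabilityMeasure P]
    (A : X →ₗ.[Ω →ₘ[P] 𝕜] X) (z : X) (W : ℝ≥0 → X) : Prop where
  mem_domain : ∀ s, W s ∈ A.domain
  cont : (N.graphNorm A).IsCont (fun s => (⟨W s, mem_domain s⟩ : A.domain))
  isC1 : N.IsC1 W
  hasDeriv : ∀ s, 0 < s → N.HasDeriv W (A ⟨W s, mem_domain s⟩) s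
  map_zero : W 0 = z

/-- `W` is a mild solution of the abstract Cauchy problem for `A` with initial value `z`:
`W ∈ C([0, ∞), X)`, the norms `‖W(u)‖`, `u ∈ [0, s]`, are order bounded in `L⁰(F, ℝ)` for each
`s ≥ 0`, and `∫₀ˢ W(u) du ∈ D(A)` with `W(s) = A ∫₀ˢ W(u) du + z`. -/
structure IsMildSolution (N : L0Norm 𝕜 P X) [IsProbabilityMeasure P]
    (A : X →ₗ.[Ω →ₘ[P] 𝕜] X) (z : X) (W : ℝ≥0 → X) : Prop where
  cont : N.IsCont W
  bddAbove : ∀ s : ℝ≥0, BddAbove ((fun u => N (W u)) '' Set.Icc 0 s)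
  integral : ∀ s : ℝ≥0, ∃ y : A.domain,
    N.HasRiemannIntegral W 0 s (y : X) ∧ W s = A y + z

end

end L0Norm

/-! The $(\varepsilon,\lambda)$-topology is convergence in probability of the norm and in general is
not locally convex, so neither a mean value inequality nor Riemann integrability comes for free. The
remedy is a change of scale. If a function is order bounded by `ξ`, or Lipschitz with constant `ξ`,
multiplication by the invertible random variable `1 / (1 + |ξ|)` makes that bound at most one
(`exists_normalizer`). For uniformly bounded elements, convergence in probability is convergence of
the expected norm `meanNorm`, a real quantity to which one-variable calculus applies; the inverse
factor carries the result back. This yields three tools: an $L^0$-Lipschitz function with zero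
derivative is constant (`eq_of_hasDeriv_zero`), increments of Lipschitz primitives are Riemann
integrals (`hasRiemannIntegral_of_hasDeriv`), and by completeness a continuous order bounded
function has a Lipschitz primitive (`exists_primitive`).

For (a), let $F$ be the primitive of $V(\cdot)z$ with $F(0)=0$. A zero-derivative argument gives
$V(h)F(s)=CF(s+h)-CF(h)$; dividing $V(h)F(s)-CF(s)$ by $h$ shows $F(s)\in D(A)$ and
$AF(s)=V(s)z-Cz$. If $z\in D(A)$, the same vector is the integral of $V(\cdot)Az$ (`primitive_eq`),
so orbits of $D(A)$ are Lipschitz and differentiable. Since $V(s)$ commutes with $A$, the family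
also acts on $[D(A)]$.

For (b), let $U$ be the difference of two solutions or, in the mild case, the integral of that
difference. Then $U(0)=0$, $U'=AU$, and $u\mapsto V(l-u)U(u)$ is $L^0$-Lipschitz with zero
derivative. Hence $CU(l)=V(l)U(0)=0$, and $U(l)=0$ because $C$ is injective (`eq_zero_of_hasDeriv`).
-/

namespace L0Norm

/-! ### Almost everywhere norm estimates, limits, derivatives and uniqueness of Riemann integrals.
-/

section Calculus

variable {𝕜 : Type*} [RCLike 𝕜] {Ω : Type*} [MeasurableSpace Ω] {P : Measure Ω}
  {X : Type*} [AddCommGroup X] [Module (Ω →ₘ[P] 𝕜) X]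

/-- The embedding of the real numbers into `L⁰(F, 𝕜)` as constant random variables. -/
noncomputable def realHom (𝕜 : Type*) [RCLike 𝕜] {Ω : Type*} [MeasurableSpace Ω]
    (P : Measure Ω) : ℝ →+* (Ω →ₘ[P] 𝕜) where
  toFun r := AEEqFun.const Ω (r : 𝕜)
  map_one' := by rw [RCLike.ofReal_one]; rfl
  map_mul' r s := by rw [RCLike.ofReal_mul]; rfl
  map_zero' := by rw [RCLike.ofReal_zero]; rfl
  map_add' r s := by rw [RCLike.ofReal_add]; rfl

theorem rsmul_eq (N : L0Norm 𝕜 P X) (r : ℝ) (x : X) : N.rsmul r x = realHom 𝕜 P r • x := rfl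

theorem map_rsmul (N : L0Norm 𝕜 P X) (T : X →ₗ[Ω →ₘ[P] 𝕜] X) (r : ℝ) (x : X) :
    T (N.rsmul r x) = N.rsmul r (T x) := by
  rw [rsmul_eq, rsmul_eq, _root_.map_smul]

theorem rsmul_sub (N : L0Norm 𝕜 P X) (r : ℝ) (x y : X) :
    N.rsmul r (x - y) = N.rsmul r x - N.rsmul r y := by
  simp only [rsmul_eq, smul_sub]

theorem sub_rsmul (N : L0Norm 𝕜 P X) (r s : ℝ) (x : X) :
    N.rsmul (r - s) x = N.rsmul r x - N.rsmul s x := by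
  simp only [rsmul_eq, map_sub, sub_smul]

theorem rsmul_rsmul (N : L0Norm 𝕜 P X) (r s : ℝ) (x : X) :
    N.rsmul r (N.rsmul s x) = N.rsmul (r * s) x := by
  simp only [rsmul_eq, map_mul, mul_smul]

theorem neg_rsmul (N : L0Norm 𝕜 P X) (r : ℝ) (x : X) : N.rsmul (-r) x = -N.rsmul r x := by
  simp only [rsmul_eq, map_neg, neg_smul]

theorem one_rsmul (N : L0Norm 𝕜 P X) (x : X) : N.rsmul 1 x = x := by
  simp only [rsmul_eq, map_one, one_smul]

theorem zero_rsmul (N : L0Norm 𝕜 P X) (x : X) : N.rsmul 0 x = 0 := by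
  rw [rsmul_eq, _root_.map_zero]
  exact zero_smul (Ω →ₘ[P] 𝕜) x

theorem rsmul_smul_comm (N : L0Norm 𝕜 P X) (r : ℝ) (w : Ω →ₘ[P] 𝕜) (x : X) :
    N.rsmul r (w • x) = w • N.rsmul r x := by
  simp only [rsmul_eq]
  exact smul_comm _ _ _

/-! ### The norm, almost everywhere -/

theorem ae_nonneg (N : L0Norm 𝕜 P X) (x : X) : ∀ᵐ ω ∂P, 0 ≤ (N x : Ω → ℝ) ω := by
  filter_upwards [AEEqFun.coeFn_le.2 (N.nonneg x), AEEqFun.coeFn_zero (α := Ω) (μ := P) (β := ℝ)]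
    with ω h h0
  rwa [h0] at h

theorem ae_add_le (N : L0Norm 𝕜 P X) (x y : X) :
    ∀ᵐ ω ∂P, (N (x + y) : Ω → ℝ) ω ≤ (N x : Ω → ℝ) ω + (N y : Ω → ℝ) ω := by
  filter_upwards [AEEqFun.coeFn_le.2 (N.add_le x y), AEEqFun.coeFn_add (N x) (N y)] with ω h h0
  rwa [h0] at h

theorem ae_smul (N : L0Norm 𝕜 P X) (w : Ω →ₘ[P] 𝕜) (x : X) :
    ∀ᵐ ω ∂P, (N (w • x) : Ω → ℝ) ω = ‖(w : Ω → 𝕜) ω‖ * (N x : Ω → ℝ) ω := by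
  rw [N.map_smul]
  filter_upwards [AEEqFun.coeFn_mul (absL0 w) (N x),
    AEEqFun.coeFn_comp (fun x : 𝕜 => ‖x‖) continuous_norm w] with ω h1 h2
  rw [h1, Pi.mul_apply, absL0, h2, Function.comp_apply]

theorem ae_rsmul (N : L0Norm 𝕜 P X) (r : ℝ) (x : X) :
    ∀ᵐ ω ∂P, (N (N.rsmul r x) : Ω → ℝ) ω = |r| * (N x : Ω → ℝ) ω := by
  filter_upwards [N.ae_smul (AEEqFun.const Ω (r : 𝕜)) x,
    AEEqFun.coeFn_const (μ := P) Ω (r : 𝕜)] with ω h1 h2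
  rw [rsmul, h1, h2, Function.const_apply, RCLike.norm_ofReal]

theorem ae_neg (N : L0Norm 𝕜 P X) (x : X) :
    ∀ᵐ ω ∂P, (N (-x) : Ω → ℝ) ω = (N x : Ω → ℝ) ω := by
  have h := N.ae_rsmul (-1) x
  rw [neg_rsmul, one_rsmul] at h
  simpa using h

theorem ae_zero (N : L0Norm 𝕜 P X) : ∀ᵐ ω ∂P, (N (0 : X) : Ω → ℝ) ω = 0 := by
  have h := N.ae_rsmul 0 (0 : X)
  rw [zero_rsmul] at h
  simpa using h

theorem ae_sub_le (N : L0Norm 𝕜 P X) (x y : X) :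
    ∀ᵐ ω ∂P, (N (x - y) : Ω → ℝ) ω ≤ (N x : Ω → ℝ) ω + (N y : Ω → ℝ) ω := by
  filter_upwards [N.ae_add_le x (-y), N.ae_neg y] with ω h1 h2
  rwa [← sub_eq_add_neg, h2] at h1

theorem ae_sub_comm (N : L0Norm 𝕜 P X) (x y : X) :
    ∀ᵐ ω ∂P, (N (x - y) : Ω → ℝ) ω = (N (y - x) : Ω → ℝ) ω := by
  have h := N.ae_neg (y - x)
  rwa [neg_sub] at h

theorem ae_le_of_mem_bounds {N : L0Norm 𝕜 P X} {T : X →ₗ[Ω →ₘ[P] 𝕜] X} {η : Ω →ₘ[P] ℝ}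
    (h : η ∈ N.bounds T) (x : X) :
    ∀ᵐ ω ∂P, (N (T x) : Ω → ℝ) ω ≤ (η : Ω → ℝ) ω * (N x : Ω → ℝ) ω := by
  filter_upwards [AEEqFun.coeFn_le.2 (h.2 x), AEEqFun.coeFn_mul η (N x)] with ω h1 h2
  rwa [h2] at h1

theorem ae_nonneg_of_mem_bounds {N : L0Norm 𝕜 P X} {T : X →ₗ[Ω →ₘ[P] 𝕜] X} {η : Ω →ₘ[P] ℝ}
    (h : η ∈ N.bounds T) : ∀ᵐ ω ∂P, 0 ≤ (η : Ω → ℝ) ω := by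
  filter_upwards [AEEqFun.coeFn_le.2 h.1, AEEqFun.coeFn_zero (α := Ω) (μ := P) (β := ℝ)]
    with ω h h0
  rwa [h0] at h

variable [IsProbabilityMeasure P]

/-! ### Convergence -/

/-- Passing to the complement turns membership into a small probability of a bad event, the form in
which monotonicity, subadditivity and Markov's inequality apply. -/
theorem mem_basicNhd_iff (N : L0Norm 𝕜 P X) {ε lam : ℝ} {x : X} :
    x ∈ N.basicNhd ε lam ↔ P.real {ω | ε ≤ (N x : Ω → ℝ) ω} < 1 - lam := by
  have hm : MeasurableSet {ω | (N x : Ω → ℝ) ω < ε} :=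
    measurableSet_lt (N x).measurable measurable_const
  have h := probReal_compl_eq_one_sub (μ := P) hm
  have h2 : {ω | (N x : Ω → ℝ) ω < ε}ᶜ = {ω | ε ≤ (N x : Ω → ℝ) ω} := by
    ext ω; simp
  rw [h2] at h
  rw [h]
  change lam < P.real {ω | (N x : Ω → ℝ) ω < ε} ↔ _
  constructor <;> intro <;> linarith

theorem mem_basicNhd_of_ae_le (N : L0Norm 𝕜 P X) {ε lam : ℝ} {x y : X}
    (hx : x ∈ N.basicNhd ε lam) (h : ∀ᵐ ω ∂P, (N y : Ω → ℝ) ω ≤ (N x : Ω → ℝ) ω) :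
    y ∈ N.basicNhd ε lam := by
  rw [mem_basicNhd_iff] at *
  refine lt_of_le_of_lt (ENNReal.toReal_mono (measure_ne_top _ _) (measure_mono_ae ?_)) hx
  filter_upwards [h] with ω h1 h2
  exact le_trans (show ε ≤ (N y : Ω → ℝ) ω from h2) h1

/-- A real factor `η` does not act on `X` directly; viewed as a `𝕜`-valued random variable it does,
and `smul_mem_basicNhd` applies. -/
theorem exists_basicNhd_of_ae_le_mul (N : L0Norm 𝕜 P X) (η : Ω →ₘ[P] ℝ) {ε lam : ℝ} (hε : 0 < ε)
    (hlam : lam ∈ Set.Ioo (0 : ℝ) 1) :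
    ∃ δ > 0, ∃ lam' ∈ Set.Ioo (0 : ℝ) 1, ∀ x ∈ N.basicNhd δ lam', ∀ y,
      (∀ᵐ ω ∂P, (N y : Ω → ℝ) ω ≤ (η : Ω → ℝ) ω * (N x : Ω → ℝ) ω) → y ∈ N.basicNhd ε lam := by
  have hcont : Continuous (fun r : ℝ => (r : 𝕜)) := RCLike.continuous_ofReal
  obtain ⟨δ, hδ, lam', hlam', h⟩ :=
    N.smul_mem_basicNhd (AEEqFun.comp (fun r : ℝ => (r : 𝕜)) hcont η) hε hlam
  refine ⟨δ, hδ, lam', hlam', fun x hx y hy => N.mem_basicNhd_of_ae_le (h x hx) ?_⟩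
  filter_upwards [hy, N.ae_smul (AEEqFun.comp (fun r : ℝ => (r : 𝕜)) hcont η) x,
    AEEqFun.coeFn_comp (fun r : ℝ => (r : 𝕜)) hcont η, N.ae_nonneg x] with ω h1 h2 h3 h4
  rw [h2, h3, Function.comp_apply, RCLike.norm_ofReal]
  exact h1.trans (mul_le_mul_of_nonneg_right (le_abs_self _) h4)

/-- Domination by a fixed random multiple suffices for convergence, since such a multiple is finite
almost surely. Continuity of a.s. bounded operators and limits along locally bounded families rest
on this. -/
theorem TendsTo.of_ae_le {N : L0Norm 𝕜 P X} {ι : Type*} {l : Filter ι} {f g : ι → X} {x y : X}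
    (hf : N.TendsTo f l x) (η : Ω →ₘ[P] ℝ)
    (h : ∀ᶠ i in l, ∀ᵐ ω ∂P,
      (N (g i - y) : Ω → ℝ) ω ≤ (η : Ω → ℝ) ω * (N (f i - x) : Ω → ℝ) ω) :
    N.TendsTo g l y := by
  rw [tendsTo_iff] at *
  intro ε hε lam hlam
  obtain ⟨δ, hδ, lam', hlam', hs⟩ := N.exists_basicNhd_of_ae_le_mul η hε hlam
  filter_upwards [hf δ hδ lam' hlam', h] with i h1 h2
  exact hs _ h1 _ h2

theorem TendsTo.map {N : L0Norm 𝕜 P X} {ι : Type*} {l : Filter ι} {f : ι → X} {x : X}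
    (hf : N.TendsTo f l x) {T : X →ₗ[Ω →ₘ[P] 𝕜] X} (hT : N.IsASBounded T) :
    N.TendsTo (fun i => T (f i)) l (T x) := by
  obtain ⟨η, hη⟩ := hT
  refine hf.of_ae_le η (Eventually.of_forall fun i => ?_)
  rw [← _root_.map_sub]
  exact ae_le_of_mem_bounds hη _

theorem TendsTo.neg {N : L0Norm 𝕜 P X} {ι : Type*} {l : Filter ι} {f : ι → X} {x : X}
    (hf : N.TendsTo f l x) : N.TendsTo (fun i => -f i) l (-x) := by
  have h := hf.smul (-1)
  simpa only [neg_smul, one_smul] using h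

theorem TendsTo.sub {N : L0Norm 𝕜 P X} {ι : Type*} {l : Filter ι} {f g : ι → X} {x y : X}
    (hf : N.TendsTo f l x) (hg : N.TendsTo g l y) :
    N.TendsTo (fun i => f i - g i) l (x - y) := by
  simpa only [sub_eq_add_neg] using hf.add hg.neg

theorem TendsTo.congr' {N : L0Norm 𝕜 P X} {ι : Type*} {l : Filter ι} {f g : ι → X} {x : X}
    (hf : N.TendsTo f l x) (h : f =ᶠ[l] g) : N.TendsTo g l x :=
  Tendsto.congr' h hf

theorem eq_zero_of_forall_mem_basicNhd (N : L0Norm 𝕜 P X) {x : X}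
    (h : ∀ ε > 0, ∀ lam ∈ Set.Ioo (0 : ℝ) 1, x ∈ N.basicNhd ε lam) : x = 0 := by
  refine TendsTo.unique (N.tendsTo_const (l := (atTop : Filter ℕ)) x) (N.tendsTo_iff.2 ?_)
  intro ε hε lam hlam
  exact Eventually.of_forall fun _ => by simpa using h ε hε lam hlam

/-- Order bounds pass to limits. -/
theorem TendsTo.ae_le {N : L0Norm 𝕜 P X} {ι : Type*} {l : Filter ι} [l.NeBot] {f : ι → X} {x : X}
    (hf : N.TendsTo f l x) {ξ : Ω → ℝ} (h : ∀ᶠ i in l, ∀ᵐ ω ∂P, (N (f i) : Ω → ℝ) ω ≤ ξ ω) :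
    ∀ᵐ ω ∂P, (N x : Ω → ℝ) ω ≤ ξ ω := by
  have key : ∀ n : ℕ, ∀ᵐ ω ∂P, ¬ (ξ ω + 1 / ((n : ℝ) + 1) ≤ (N x : Ω → ℝ) ω) := by
    intro n
    have hn : (0 : ℝ) < 1 / ((n : ℝ) + 1) := by positivity
    have hreal : P.real {ω | ξ ω + 1 / ((n : ℝ) + 1) ≤ (N x : Ω → ℝ) ω} ≤ 0 := by
      refine le_of_forall_pos_lt_add fun c hc => ?_
      -- This level makes the exceptional probability smaller than `c`; the cap `1 / 2` keeps the
      -- level positive.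
      have hmem : 1 - min c (1 / 2) ∈ Set.Ioo (0 : ℝ) 1 := by
        have : min c (1 / 2) ≤ 1 / 2 := min_le_right _ _
        have h3 : 0 < min c (1 / 2) := lt_min hc (by norm_num)
        constructor <;> linarith
      obtain ⟨i, hi, hi'⟩ := ((tendsTo_iff N).1 hf _ hn _ hmem |>.and h).exists
      rw [mem_basicNhd_iff] at hi
      have h4 : P.real {ω | ξ ω + 1 / ((n : ℝ) + 1) ≤ (N x : Ω → ℝ) ω} ≤
          P.real {ω | 1 / ((n : ℝ) + 1) ≤ (N (f i - x) : Ω → ℝ) ω} := by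
        refine ENNReal.toReal_mono (measure_ne_top _ _) (measure_mono_ae ?_)
        filter_upwards [hi', N.ae_sub_le (f i) (f i - x)] with ω h5 h6 h7
        rw [sub_sub_cancel] at h6
        have h7' : ξ ω + 1 / ((n : ℝ) + 1) ≤ (N x : Ω → ℝ) ω := h7
        change 1 / ((n : ℝ) + 1) ≤ (N (f i - x) : Ω → ℝ) ω
        linarith
      have := min_le_left c (1 / 2)
      linarith
    have h0 : P {ω | ξ ω + 1 / ((n : ℝ) + 1) ≤ (N x : Ω → ℝ) ω} = 0 := by
      rw [← measureReal_eq_zero_iff]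
      exact le_antisymm hreal measureReal_nonneg
    rw [ae_iff]
    simpa using h0
  filter_upwards [ae_all_iff.2 key] with ω hω
  refine le_of_forall_pos_le_add fun c hc => ?_
  obtain ⟨n, hn⟩ := exists_nat_one_div_lt hc
  have := not_le.1 (hω n)
  linarith

theorem isCont_iff (N : L0Norm 𝕜 P X) {f : ℝ≥0 → X} :
    N.IsCont f ↔ ∀ s, N.TendsTo f (𝓝 s) (f s) := by
  let := N.topology
  exact continuous_iff_continuousAt

theorem hasDeriv_sub {N : L0Norm 𝕜 P X} {f g : ℝ≥0 → X} {y z : X} {s : ℝ≥0}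
    (hf : N.HasDeriv f y s) (hg : N.HasDeriv g z s) :
    N.HasDeriv (fun u => f u - g u) (y - z) s := by
  refine (TendsTo.sub hf hg).congr' (Eventually.of_forall fun t => ?_)
  simp only [rsmul_eq]
  module

theorem hasDeriv_smul {N : L0Norm 𝕜 P X} {f : ℝ≥0 → X} {y : X} {s : ℝ≥0}
    (hf : N.HasDeriv f y s) (w : Ω →ₘ[P] 𝕜) : N.HasDeriv (fun u => w • f u) (w • y) s := by
  refine (TendsTo.smul w hf).congr' (Eventually.of_forall fun t => ?_)
  simp only [rsmul_eq]
  module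

theorem hasDeriv_map {N : L0Norm 𝕜 P X} {f : ℝ≥0 → X} {y : X} {s : ℝ≥0}
    (hf : N.HasDeriv f y s) {T : X →ₗ[Ω →ₘ[P] 𝕜] X} (hT : N.IsASBounded T) :
    N.HasDeriv (fun u => T (f u)) (T y) s := by
  refine (TendsTo.map hf hT).congr' (Eventually.of_forall fun t => ?_)
  simp only [map_rsmul, _root_.map_sub]

theorem hasDeriv_congr {N : L0Norm 𝕜 P X} {f g : ℝ≥0 → X} {y : X} {s : ℝ≥0}
    (hf : N.HasDeriv f y s) (h : f =ᶠ[𝓝 s] g) : N.HasDeriv g y s := by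
  refine TendsTo.congr' hf ?_
  have h1 : ∀ᶠ t in 𝓝[≠] s, f t = g t := h.filter_mono nhdsWithin_le_nhds
  filter_upwards [h1] with t ht
  rw [ht, h.self_of_nhds]

theorem HasRiemannIntegral.smul {N : L0Norm 𝕜 P X} {f : ℝ≥0 → X} {a b : ℝ≥0} {y : X}
    (h : N.HasRiemannIntegral f a b y) (w : Ω →ₘ[P] 𝕜) :
    N.HasRiemannIntegral (fun u => w • f u) a b (w • y) := by
  intro ε hε lam hlam
  obtain ⟨δ, hδ, lam', hlam', hs⟩ := N.smul_mem_basicNhd w hε hlam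
  obtain ⟨d, hd, h1⟩ := h δ hδ lam' hlam'
  refine ⟨d, hd, fun n t τ h0 hn ht => ?_⟩
  have := hs _ (h1 n t τ h0 hn ht)
  rw [smul_sub, Finset.smul_sum] at this
  simpa only [rsmul_smul_comm] using this

/-- Riemann integrals are unique, as there are partitions of arbitrarily small mesh. -/
theorem HasRiemannIntegral.unique {N : L0Norm 𝕜 P X} {f : ℝ≥0 → X} {b : ℝ≥0} {y z : X}
    (hy : N.HasRiemannIntegral f 0 b y) (hz : N.HasRiemannIntegral f 0 b z) : y = z := by
  rw [← sub_eq_zero]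
  refine N.eq_zero_of_forall_mem_basicNhd fun ε hε lam hlam => ?_
  have hl : (1 + lam) / 2 ∈ Set.Ioo (0 : ℝ) 1 := ⟨by linarith [hlam.1], by linarith [hlam.2]⟩
  obtain ⟨d, hd, h1⟩ := hy (ε / 2) (by positivity) _ hl
  obtain ⟨d', hd', h2⟩ := hz (ε / 2) (by positivity) _ hl
  obtain ⟨n, hn⟩ := exists_nat_gt ((b : ℝ) / min d d')
  have hmin : 0 < min d d' := lt_min hd hd'
  have hn0 : (0 : ℝ) < n := lt_of_le_of_lt (by positivity) hn
  have hmesh : (b : ℝ) / n < min d d' := by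
    rw [div_lt_iff₀ hmin] at hn
    rw [div_lt_iff₀ hn0]
    linarith
  have hn0' : (n : ℝ≥0) ≠ 0 := by
    intro h
    have : (n : ℝ) = 0 := by exact_mod_cast h
    linarith
  let t : ℕ → ℝ≥0 := fun i => i * (b / n)
  have ht : ∀ i < n, t i ≤ t i ∧ t i ≤ t (i + 1) ∧ (t (i + 1) : ℝ) - t i < min d d' := by
    intro i _
    refine ⟨le_rfl, mul_le_mul_left (by exact_mod_cast Nat.le_succ i) _, ?_⟩
    have : (t (i + 1) : ℝ) - t i = b / n := by
      simp only [t]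
      push_cast
      ring
    rwa [this]
  have h0 : t 0 = 0 := by simp [t]
  have hb : t n = b := mul_div_cancel₀ _ hn0'
  have e1 := h1 n t t h0 hb fun i hi => ⟨(ht i hi).1, (ht i hi).2.1,
    (ht i hi).2.2.trans_le (min_le_left _ _)⟩
  have e2 := h2 n t t h0 hb fun i hi => ⟨(ht i hi).1, (ht i hi).2.1,
    (ht i hi).2.2.trans_le (min_le_right _ _)⟩
  have e1' := N.mem_basicNhd_of_ae_le e1 ((N.ae_neg _).mono fun ω h => h.le)
  have := N.add_mem_basicNhd e1' e2
  convert this using 1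
  abel

end Calculus

/-! ### Expected norms: comparison with the topology, and a mean value inequality. -/

section MeanNorm

variable {𝕜 : Type*} [RCLike 𝕜] {Ω : Type*} [MeasurableSpace Ω] {P : Measure Ω}
  {X : Type*} [AddCommGroup X] [Module (Ω →ₘ[P] 𝕜) X]

/-! ### The mean of the `L⁰`-norm -/

/-- The expectation of `‖x‖`. -/
noncomputable def meanNorm (N : L0Norm 𝕜 P X) (x : X) : ℝ := ∫ ω, (N x : Ω → ℝ) ω ∂P

/-- `‖x‖` is integrable. -/
def IsInt (N : L0Norm 𝕜 P X) (x : X) : Prop := Integrable (N x : Ω → ℝ) P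

theorem IsInt.mono {N : L0Norm 𝕜 P X} {x y : X} (hx : N.IsInt x)
    (h : ∀ᵐ ω ∂P, (N y : Ω → ℝ) ω ≤ (N x : Ω → ℝ) ω) : N.IsInt y := by
  refine Integrable.mono' hx (N y).aestronglyMeasurable ?_
  filter_upwards [h, N.ae_nonneg y] with ω h1 h2
  rwa [Real.norm_of_nonneg h2]

theorem IsInt.add {N : L0Norm 𝕜 P X} {x y : X} (hx : N.IsInt x) (hy : N.IsInt y) :
    N.IsInt (x + y) := by
  refine Integrable.mono' (Integrable.add hx hy) (N (x + y)).aestronglyMeasurable ?_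
  filter_upwards [N.ae_add_le x y, N.ae_nonneg (x + y)] with ω h1 h2
  rwa [Real.norm_of_nonneg h2]

theorem IsInt.neg {N : L0Norm 𝕜 P X} {x : X} (hx : N.IsInt x) : N.IsInt (-x) :=
  hx.mono ((N.ae_neg x).mono fun _ h => h.le)

theorem IsInt.sub {N : L0Norm 𝕜 P X} {x y : X} (hx : N.IsInt x) (hy : N.IsInt y) :
    N.IsInt (x - y) := by
  rw [sub_eq_add_neg]
  exact hx.add hy.neg

theorem IsInt.rsmul {N : L0Norm 𝕜 P X} {x : X} (hx : N.IsInt x) (r : ℝ) :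
    N.IsInt (N.rsmul r x) :=
  (Integrable.const_mul hx |r|).congr ((N.ae_rsmul r x).mono fun _ h => h.symm)

theorem meanNorm_nonneg (N : L0Norm 𝕜 P X) (x : X) : 0 ≤ N.meanNorm x :=
  integral_nonneg_of_ae (N.ae_nonneg x)

theorem meanNorm_neg (N : L0Norm 𝕜 P X) (x : X) : N.meanNorm (-x) = N.meanNorm x :=
  integral_congr_ae (N.ae_neg x)

theorem meanNorm_sub_comm (N : L0Norm 𝕜 P X) (x y : X) :
    N.meanNorm (x - y) = N.meanNorm (y - x) :=
  integral_congr_ae (N.ae_sub_comm x y)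

theorem meanNorm_zero (N : L0Norm 𝕜 P X) : N.meanNorm (0 : X) = 0 := by
  rw [meanNorm, integral_congr_ae N.ae_zero, integral_zero]

theorem meanNorm_add_le {N : L0Norm 𝕜 P X} {x y : X} (hx : N.IsInt x) (hy : N.IsInt y) :
    N.meanNorm (x + y) ≤ N.meanNorm x + N.meanNorm y := by
  rw [meanNorm, meanNorm, meanNorm, ← integral_add hx hy]
  exact integral_mono_ae (hx.add hy) (Integrable.add hx hy) (N.ae_add_le x y)

theorem meanNorm_sub_le {N : L0Norm 𝕜 P X} {x y : X} (hx : N.IsInt x) (hy : N.IsInt y) :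
    N.meanNorm (x - y) ≤ N.meanNorm x + N.meanNorm y := by
  rw [sub_eq_add_neg, ← N.meanNorm_neg y]
  exact meanNorm_add_le hx hy.neg

theorem meanNorm_rsmul (N : L0Norm 𝕜 P X) (r : ℝ) (x : X) :
    N.meanNorm (N.rsmul r x) = |r| * N.meanNorm x := by
  rw [meanNorm, integral_congr_ae (N.ae_rsmul r x), integral_const_mul, meanNorm]

theorem meanNorm_sum_le {N : L0Norm 𝕜 P X} {f : ℕ → X} {n : ℕ} (h : ∀ i < n, N.IsInt (f i)) :
    N.meanNorm (∑ i ∈ Finset.range n, f i) ≤ ∑ i ∈ Finset.range n, N.meanNorm (f i) ∧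
      N.IsInt (∑ i ∈ Finset.range n, f i) := by
  induction n with
  | zero =>
    simp only [Finset.range_zero, Finset.sum_empty]
    exact ⟨N.meanNorm_zero.le, (integrable_zero Ω ℝ P).congr (N.ae_zero.mono fun _ h => h.symm)⟩
  | succ n ih =>
    obtain ⟨h1, h2⟩ := ih fun i hi => h i (hi.trans n.lt_succ_self)
    rw [Finset.sum_range_succ, Finset.sum_range_succ]
    exact ⟨(meanNorm_add_le h2 (h n n.lt_succ_self)).trans (by gcongr),
      h2.add (h n n.lt_succ_self)⟩

theorem eq_zero_of_meanNorm_le_zero {N : L0Norm 𝕜 P X} {x : X} (hx : N.IsInt x)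
    (h : N.meanNorm x ≤ 0) : x = 0 := by
  have h0 := (integral_eq_zero_iff_of_nonneg_ae (N.ae_nonneg x) hx).1
    (le_antisymm h (N.meanNorm_nonneg x))
  apply N.eq_zero_of_map_eq_zero
  apply AEEqFun.ext
  filter_upwards [h0, AEEqFun.coeFn_zero (α := Ω) (μ := P) (β := ℝ)] with ω h1 h2
  rw [h1, h2]

theorem ae_sum_le {N : L0Norm 𝕜 P X} {f : ℕ → X} {c : ℕ → Ω → ℝ} {n : ℕ}
    (h : ∀ i < n, ∀ᵐ ω ∂P, (N (f i) : Ω → ℝ) ω ≤ c i ω) :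
    ∀ᵐ ω ∂P, (N (∑ i ∈ Finset.range n, f i) : Ω → ℝ) ω ≤ ∑ i ∈ Finset.range n, c i ω := by
  induction n with
  | zero =>
    simp only [Finset.range_zero, Finset.sum_empty]
    exact N.ae_zero.mono fun _ h => h.le
  | succ n ih =>
    simp only [Finset.sum_range_succ]
    filter_upwards [ih fun i hi => h i (hi.trans n.lt_succ_self), h n n.lt_succ_self,
      N.ae_add_le (∑ i ∈ Finset.range n, f i) (f n)] with ω h1 h2 h3
    linarith

variable [IsProbabilityMeasure P]

theorem isInt_of_ae_le {N : L0Norm 𝕜 P X} {x : X} {c : ℝ}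
    (h : ∀ᵐ ω ∂P, (N x : Ω → ℝ) ω ≤ c) : N.IsInt x := by
  refine Integrable.mono' (integrable_const c) (N x).aestronglyMeasurable ?_
  filter_upwards [h, N.ae_nonneg x] with ω h1 h2
  rwa [Real.norm_of_nonneg h2]

theorem meanNorm_le_of_ae_le {N : L0Norm 𝕜 P X} {x : X} {c : ℝ}
    (h : ∀ᵐ ω ∂P, (N x : Ω → ℝ) ω ≤ c) : N.meanNorm x ≤ c := by
  have := integral_mono_ae (isInt_of_ae_le h) (integrable_const c) h
  simpa [meanNorm] using this

/-- Markov's inequality. -/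
theorem mem_basicNhd_of_meanNorm_lt {N : L0Norm 𝕜 P X} {ε lam : ℝ} {x : X} (hε : 0 < ε)
    (hx : N.IsInt x) (h : N.meanNorm x < ε * (1 - lam)) : x ∈ N.basicNhd ε lam := by
  rw [mem_basicNhd_iff]
  have h1 := mul_meas_ge_le_integral_of_nonneg (N.ae_nonneg x) hx ε
  exact lt_of_mul_lt_mul_left (h1.trans_lt h) hε.le

/-- The norm is below `ε` outside an event of probability less than `1 - lam`, and at most `c` on
that event. Together with Markov's inequality this makes the topology and the mean agree on bounded
sets. -/
theorem meanNorm_le_of_mem_basicNhd {N : L0Norm 𝕜 P X} {ε lam c : ℝ} {x : X} (hε : 0 ≤ ε)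
    (hc : 0 ≤ c) (hx : x ∈ N.basicNhd ε lam) (h : ∀ᵐ ω ∂P, (N x : Ω → ℝ) ω ≤ c) :
    N.meanNorm x ≤ ε + c * (1 - lam) := by
  rw [mem_basicNhd_iff] at hx
  have hm : MeasurableSet {ω | ε ≤ (N x : Ω → ℝ) ω} :=
    measurableSet_le measurable_const (N x).measurable
  have hi : Integrable ({ω | ε ≤ (N x : Ω → ℝ) ω}.indicator fun _ => c) P :=
    (integrable_const c).indicator hm
  have h1 : N.meanNorm x ≤ ∫ ω, (ε + {ω | ε ≤ (N x : Ω → ℝ) ω}.indicator (fun _ => c) ω) ∂P := by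
    refine integral_mono_ae (isInt_of_ae_le h) ((integrable_const ε).add hi) ?_
    filter_upwards [h] with ω h2
    by_cases h3 : ε ≤ (N x : Ω → ℝ) ω
    · rw [Set.indicator_of_mem (by exact h3)]
      linarith
    · rw [Set.indicator_of_notMem (by exact h3)]
      linarith
  rw [integral_add (integrable_const ε) hi, integral_indicator_const _ hm] at h1
  simp only [integral_const, probReal_univ, smul_eq_mul, one_mul] at h1
  nlinarith

theorem TendsTo.tendsto_meanNorm {N : L0Norm 𝕜 P X} {ι : Type*} {l : Filter ι} {f : ι → X} {x : X}
    (hf : N.TendsTo f l x) {c : ℝ} (hc : 0 ≤ c)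
    (h : ∀ᶠ i in l, ∀ᵐ ω ∂P, (N (f i - x) : Ω → ℝ) ω ≤ c) :
    Tendsto (fun i => N.meanNorm (f i - x)) l (𝓝 0) := by
  rw [Metric.tendsto_nhds]
  intro ε hε
  -- The exceptional probability is taken so small that it contributes at most `ε / 4` to the mean;
  -- `c + 1` allows `c = 0`.
  have hlam : 1 - min (ε / (4 * (c + 1))) (1 / 2) ∈ Set.Ioo (0 : ℝ) 1 := by
    have h2 : min (ε / (4 * (c + 1))) (1 / 2) ≤ 1 / 2 := min_le_right _ _
    have h3 : 0 < min (ε / (4 * (c + 1))) (1 / 2) := lt_min (by positivity) (by norm_num)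
    constructor <;> linarith
  filter_upwards [h, N.tendsTo_iff.1 hf (ε / 4) (by positivity) _ hlam] with i h1 h2
  have h3 := meanNorm_le_of_mem_basicNhd (by positivity) hc h2 h1
  rw [Real.dist_eq, sub_zero, abs_of_nonneg (N.meanNorm_nonneg _)]
  have h4 : c * (1 - (1 - min (ε / (4 * (c + 1))) (1 / 2))) ≤ ε / 4 := by
    rw [sub_sub_cancel]
    calc c * min (ε / (4 * (c + 1))) (1 / 2) ≤ (c + 1) * (ε / (4 * (c + 1))) := by
          gcongr
          · linarith
          · exact min_le_left _ _
      _ = ε / 4 := by field_simp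
  linarith

theorem tendsTo_of_tendsto_meanNorm {N : L0Norm 𝕜 P X} {ι : Type*} {l : Filter ι} {f : ι → X}
    {x : X} (hi : ∀ᶠ i in l, N.IsInt (f i - x))
    (h : Tendsto (fun i => N.meanNorm (f i - x)) l (𝓝 0)) : N.TendsTo f l x := by
  rw [tendsTo_iff]
  intro ε hε lam hlam
  have hpos : 0 < ε * (1 - lam) := mul_pos hε (by linarith [hlam.2])
  filter_upwards [hi, h.eventually (gt_mem_nhds hpos)] with i h1 h2
  exact mem_basicNhd_of_meanNorm_lt hε h1 h2

/-! ### A mean value inequality -/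

/-- The real function $x\mapsto E\|\Phi(x)-\Phi(s)\|$ is Lipschitz, and by the triangle inequality
its right slopes are eventually at most $K+\varepsilon$, so it stays below $K(x-s)$. The Lipschitz
bound also makes all norms involved integrable. -/
theorem meanNorm_sub_le_of_slope_le {N : L0Norm 𝕜 P X} {Φ : ℝ≥0 → X} {s t : ℝ≥0} (hst : s ≤ t)
    {c K : ℝ}
    (hL : ∀ u ∈ Set.Icc s t, ∀ v ∈ Set.Icc s t,
      ∀ᵐ ω ∂P, (N (Φ u - Φ v) : Ω → ℝ) ω ≤ c * |(u : ℝ) - v|)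
    (hK : ∀ u ∈ Set.Ico s t, ∀ ε > 0, ∀ᶠ v : ℝ≥0 in 𝓝[>] u,
      N.meanNorm (Φ v - Φ u) ≤ (K + ε) * ((v : ℝ) - u)) :
    N.meanNorm (Φ t - Φ s) ≤ K * ((t : ℝ) - s) := by
  have hs : s ∈ Set.Icc s t := ⟨le_rfl, hst⟩
  have hmem : ∀ x ∈ Set.Icc (s : ℝ) t, x.toNNReal ∈ Set.Icc s t ∧ (x.toNNReal : ℝ) = x := by
    intro x hx
    have h0 : 0 ≤ x := s.2.trans hx.1
    have h1 : (x.toNNReal : ℝ) = x := Real.coe_toNNReal x h0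
    refine ⟨⟨?_, ?_⟩, h1⟩ <;> rw [← NNReal.coe_le_coe, h1]
    exacts [hx.1, hx.2]
  have hint : ∀ u ∈ Set.Icc s t, ∀ v ∈ Set.Icc s t, N.IsInt (Φ u - Φ v) := fun u hu v hv =>
    isInt_of_ae_le (hL u hu v hv)
  have htri : ∀ u ∈ Set.Icc s t, ∀ v ∈ Set.Icc s t,
      N.meanNorm (Φ u - Φ s) - N.meanNorm (Φ v - Φ s) ≤ N.meanNorm (Φ u - Φ v) := by
    intro u hu v hv
    have := meanNorm_add_le (hint u hu v hv) (hint v hv s hs)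
    rw [sub_add_sub_cancel] at this
    linarith
  have hcont : ContinuousOn (fun x : ℝ => N.meanNorm (Φ x.toNNReal - Φ s)) (Set.Icc (s : ℝ) t) := by
    refine LipschitzOnWith.continuousOn (K := c.toNNReal) (LipschitzOnWith.of_dist_le_mul ?_)
    intro x hx y hy
    obtain ⟨hx1, hx2⟩ := hmem x hx
    obtain ⟨hy1, hy2⟩ := hmem y hy
    have h1 := htri _ hx1 _ hy1
    have h2 := htri _ hy1 _ hx1
    rw [N.meanNorm_sub_comm (Φ y.toNNReal) (Φ x.toNNReal)] at h2
    have h3 := meanNorm_le_of_ae_le (hL _ hx1 _ hy1)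
    rw [hx2, hy2] at h3
    rw [Real.dist_eq, Real.dist_eq, abs_le]
    have h4 : c * |x - y| ≤ c.toNNReal * |x - y| :=
      mul_le_mul_of_nonneg_right (Real.le_coe_toNNReal c) (abs_nonneg _)
    constructor <;> linarith
  have hmain := image_le_of_liminf_slope_right_le_deriv_boundary (a := (s : ℝ)) (b := t) hcont
    (B := fun x => K * (x - s)) (B' := fun _ => K) ?_ (by fun_prop) ?_ ?_
    (x := (t : ℝ)) ⟨by exact_mod_cast hst, le_rfl⟩
  · simpa using hmain
  · simp [N.meanNorm_zero]
  · intro x _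
    simpa using (((hasDerivAt_id x).sub_const (s : ℝ)).const_mul K).hasDerivWithinAt
  · intro x hx r hr
    obtain ⟨hx1, hx2⟩ := hmem x ⟨hx.1, hx.2.le⟩
    have hx3 : x.toNNReal < t := by rw [← NNReal.coe_lt_coe, hx2]; exact hx.2
    have htend : Tendsto Real.toNNReal (𝓝[>] x) (𝓝[>] x.toNNReal) := by
      refine tendsto_nhdsWithin_iff.2
        ⟨continuous_real_toNNReal.continuousAt.mono_left nhdsWithin_le_nhds, ?_⟩
      filter_upwards [self_mem_nhdsWithin] with y hy
      have hy' : x < y := hy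
      exact (Real.toNNReal_lt_toNNReal_iff ((s.2.trans hx.1).trans_lt hy')).2 hy'
    -- Half of the gap `r - K` is spent, so that the slope is strictly below `r`.
    have hev := htend.eventually (hK _ ⟨hx1.1, hx3⟩ ((r - K) / 2) (by linarith))
    refine Eventually.frequently ?_
    filter_upwards [hev, self_mem_nhdsWithin, Ioo_mem_nhdsGT hx.2] with y hy hxy hyt
    have hxy' : x < y := hxy
    obtain ⟨hy1, hy2⟩ := hmem y ⟨hx.1.trans hxy'.le, hyt.2.le⟩
    have h1 := htri _ hy1 _ hx1
    rw [hx2, hy2] at hy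
    rw [slope_def_field, div_lt_iff₀ (by linarith)]
    have : (K + (r - K) / 2) * (y - x) < r * (y - x) :=
      mul_lt_mul_of_pos_right (by linarith) (by linarith)
    linarith

/-- A derivative is the derivative in mean from the right, for a Lipschitz function. -/
theorem HasDeriv.meanNorm_sub_le {N : L0Norm 𝕜 P X} {F : ℝ≥0 → X} {y : X} {u : ℝ≥0}
    (h : N.HasDeriv F y u) {c : ℝ} (hc : 0 ≤ c)
    (hL : ∀ᶠ v in 𝓝[>] u, ∀ᵐ ω ∂P, (N (F v - F u) : Ω → ℝ) ω ≤ c * |(v : ℝ) - u|)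
    {ε : ℝ} (hε : 0 < ε) :
    ∀ᶠ v : ℝ≥0 in 𝓝[>] u,
      N.meanNorm (F v - F u - N.rsmul ((v : ℝ) - u) y) ≤ ε * ((v : ℝ) - u) := by
  have h1 : N.TendsTo (fun t : ℝ≥0 => N.rsmul ((t : ℝ) - u)⁻¹ (F t - F u)) (𝓝[>] u) y :=
    Tendsto.mono_left h (nhdsWithin_mono u fun v hv => ne_of_gt hv)
  have hb : ∀ᶠ v : ℝ≥0 in 𝓝[>] u, ∀ᵐ ω ∂P,
      (N (N.rsmul ((v : ℝ) - u)⁻¹ (F v - F u)) : Ω → ℝ) ω ≤ c := by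
    filter_upwards [hL, self_mem_nhdsWithin] with v hv huv
    have huv' : (0 : ℝ) < (v : ℝ) - u := sub_pos.2 (by exact_mod_cast huv)
    filter_upwards [hv, N.ae_rsmul ((v : ℝ) - u)⁻¹ (F v - F u)] with ω h2 h3
    rw [h3, abs_inv, inv_mul_le_iff₀ (abs_pos.2 huv'.ne'), mul_comm]
    exact h2
  -- The difference quotients are bounded by `c`, hence so is their limit. The error is then bounded
  -- by `2 c`, and convergence in the topology becomes convergence in mean.
  have hy := h1.ae_le hb
  have h2 := h1.tendsto_meanNorm (c := c + c) (by linarith) (by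
    filter_upwards [hb] with v hv
    filter_upwards [hv, hy, N.ae_sub_le (N.rsmul ((v : ℝ) - u)⁻¹ (F v - F u)) y] with ω h3 h4 h5
    linarith)
  filter_upwards [h2.eventually (gt_mem_nhds hε), self_mem_nhdsWithin] with v hv huv
  have huv' : (0 : ℝ) < (v : ℝ) - u := sub_pos.2 (by exact_mod_cast huv)
  have h6 : F v - F u - N.rsmul ((v : ℝ) - u) y =
      N.rsmul ((v : ℝ) - u) (N.rsmul ((v : ℝ) - u)⁻¹ (F v - F u) - y) := by
    rw [rsmul_sub, rsmul_rsmul, mul_inv_cancel₀ huv'.ne', one_rsmul]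
  rw [h6, meanNorm_rsmul, abs_of_pos huv', mul_comm]
  exact mul_le_mul_of_nonneg_right hv.le huv'.le

/-- A continuous bounded function is uniformly continuous in mean on compact intervals. -/
theorem IsCont.exists_meanNorm_sub_lt {N : L0Norm 𝕜 P X} {f : ℝ≥0 → X} (hf : N.IsCont f)
    {l : ℝ≥0} {c : ℝ} (hc : 0 ≤ c) (hb : ∀ u ≤ l, ∀ᵐ ω ∂P, (N (f u) : Ω → ℝ) ω ≤ c) {ε : ℝ}
    (hε : 0 < ε) :
    ∃ δ > 0, ∀ u ≤ l, ∀ v ≤ l, |(u : ℝ) - v| < δ → N.meanNorm (f u - f v) < ε := by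
  -- Clamping time at `l` gives a function bounded on the whole half-line without changing it on
  -- `[0, l]`.
  have hcont : ∀ u, Tendsto (fun v => N.meanNorm (f (min v l) - f (min u l))) (𝓝 u) (𝓝 0) := by
    intro u
    have h1 : N.TendsTo (fun v => f (min v l)) (𝓝 u) (f (min u l)) :=
      Tendsto.comp ((N.isCont_iff.1 hf) (min u l))
        ((continuous_id.min continuous_const).tendsto u)
    refine h1.tendsto_meanNorm (c := c + c) (by linarith) (Eventually.of_forall fun v => ?_)
    filter_upwards [hb _ (min_le_right v l), hb _ (min_le_right u l),
      N.ae_sub_le (f (min v l)) (f (min u l))] with ω h2 h3 h4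
    linarith
  have hint : ∀ u v, N.IsInt (f (min u l) - f (min v l)) := fun u v =>
    (isInt_of_ae_le (hb _ (min_le_right u l))).sub (isInt_of_ae_le (hb _ (min_le_right v l)))
  have hH : Continuous fun q : ℝ≥0 × ℝ≥0 => N.meanNorm (f (min q.1 l) - f (min q.2 l)) := by
    rw [continuous_iff_continuousAt]
    rintro ⟨u, v⟩
    rw [ContinuousAt, tendsto_iff_dist_tendsto_zero]
    have hlim : Tendsto (fun q : ℝ≥0 × ℝ≥0 => N.meanNorm (f (min q.1 l) - f (min u l)) +
        N.meanNorm (f (min q.2 l) - f (min v l))) (𝓝 (u, v)) (𝓝 0) := by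
      have := ((hcont u).comp (continuous_fst.tendsto (u, v))).add
        ((hcont v).comp (continuous_snd.tendsto (u, v)))
      simpa using this
    refine squeeze_zero (fun _ => dist_nonneg) (fun q => ?_) hlim
    rw [Real.dist_eq, abs_le]
    have h1 := meanNorm_sub_le (hint q.1 u) (hint q.2 v)
    have h2 := meanNorm_add_le (hint u v) ((hint q.1 u).sub (hint q.2 v))
    have h3 := meanNorm_sub_le (hint q.1 q.2) ((hint q.1 u).sub (hint q.2 v))
    rw [show f (min u l) - f (min v l) + (f (min q.1 l) - f (min u l) -
      (f (min q.2 l) - f (min v l))) = f (min q.1 l) - f (min q.2 l) by abel] at h2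
    rw [show f (min q.1 l) - f (min q.2 l) - (f (min q.1 l) - f (min u l) -
      (f (min q.2 l) - f (min v l))) = f (min u l) - f (min v l) by abel] at h3
    simp only
    constructor <;> linarith
  have hK : IsCompact (Set.Icc (0 : ℝ≥0) l ×ˢ Set.Icc (0 : ℝ≥0) l) := isCompact_Icc.prod isCompact_Icc
  have hu := hK.uniformContinuousOn_of_continuous hH.continuousOn
  rw [Metric.uniformContinuousOn_iff] at hu
  obtain ⟨δ, hδ, h⟩ := hu ε hε
  refine ⟨δ, hδ, fun u hul v hvl huv => ?_⟩
  -- The comparison point lies on the diagonal, where the mean distance vanishes.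
  have := h (u, v) ⟨⟨zero_le, hul⟩, ⟨zero_le, hvl⟩⟩ (v, v) ⟨⟨zero_le, hvl⟩, ⟨zero_le, hvl⟩⟩ (by
    rw [Prod.dist_eq, dist_self, max_eq_left dist_nonneg, NNReal.dist_eq]
    exact huv)
  simp only [sub_self, meanNorm_zero, dist_zero_right, min_eq_left hul, min_eq_left hvl] at this
  rwa [Real.norm_of_nonneg (N.meanNorm_nonneg _)] at this

end MeanNorm

/-! ### Normalization, functions with zero derivative, and Riemann integrals from primitives. -/

section Primitive

variable {𝕜 : Type*} [RCLike 𝕜] {Ω : Type*} [MeasurableSpace Ω] {P : Measure Ω}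
  {X : Type*} [AddCommGroup X] [Module (Ω →ₘ[P] 𝕜) X]

/-! ### Normalization -/

/-- Every real random variable `ξ` becomes bounded by `1` after multiplication with an
invertible one. -/
theorem exists_normalizer (𝕜 : Type*) [RCLike 𝕜] {Ω : Type*} [MeasurableSpace Ω] {P : Measure Ω}
    (ξ : Ω →ₘ[P] ℝ) :
    ∃ w w' : Ω →ₘ[P] 𝕜, w' * w = 1 ∧ (∀ᵐ ω ∂P, ‖(w' : Ω → 𝕜) ω‖ * ‖(w : Ω → 𝕜) ω‖ = 1) ∧
      ∀ᵐ ω ∂P, ‖(w : Ω → 𝕜) ω‖ * (ξ : Ω → ℝ) ω ≤ 1 := by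
  -- The normalizer is `1 / (1 + |ξ|)` with inverse `1 + |ξ|`. Both are continuous functions of `ξ`,
  -- so they define elements of $L^0$, and the summand `1` prevents division by zero.
  have h1 : Continuous fun r : ℝ => ((1 + |r| : ℝ) : 𝕜) :=
    RCLike.continuous_ofReal.comp (by fun_prop)
  have hpos : ∀ r : ℝ, 0 < 1 + |r| := fun r => by positivity
  have h2 : Continuous fun r : ℝ => (((1 + |r|)⁻¹ : ℝ) : 𝕜) :=
    RCLike.continuous_ofReal.comp
      (Continuous.inv₀ (by fun_prop) fun r => (hpos r).ne')
  have e1 := AEEqFun.coeFn_comp (μ := P) _ h1 ξ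
  have e2 := AEEqFun.coeFn_comp (μ := P) _ h2 ξ
  have hmul : AEEqFun.comp _ h1 ξ * AEEqFun.comp _ h2 ξ = 1 := by
    apply AEEqFun.ext
    filter_upwards [e1, e2, AEEqFun.coeFn_mul (AEEqFun.comp _ h1 ξ) (AEEqFun.comp _ h2 ξ),
      AEEqFun.coeFn_one (α := Ω) (μ := P) (β := 𝕜)] with ω h3 h4 h5 h6
    rw [h5, h6, Pi.mul_apply, h3, h4, Function.comp_apply, Function.comp_apply, Pi.one_apply,
      ← RCLike.ofReal_mul, mul_inv_cancel₀ (hpos _).ne', RCLike.ofReal_one]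
  refine ⟨AEEqFun.comp _ h2 ξ, AEEqFun.comp _ h1 ξ, hmul, ?_, ?_⟩
  · filter_upwards [e1, e2] with ω h3 h4
    rw [h3, h4, Function.comp_apply, Function.comp_apply, RCLike.norm_ofReal, RCLike.norm_ofReal,
      ← abs_mul, mul_inv_cancel₀ (hpos _).ne', abs_one]
  · filter_upwards [e2] with ω h4
    rw [h4, Function.comp_apply, RCLike.norm_ofReal, abs_of_pos (inv_pos.2 (hpos _)),
      inv_mul_le_iff₀ (hpos _)]
    linarith [le_abs_self ((ξ : Ω → ℝ) ω)]

theorem ae_le_of_smul {N : L0Norm 𝕜 P X} {w : Ω →ₘ[P] 𝕜} {x : X} {ξ : Ω → ℝ} {r : ℝ}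
    (hr : 0 ≤ r) (hx : ∀ᵐ ω ∂P, (N x : Ω → ℝ) ω ≤ r * ξ ω)
    (hw : ∀ᵐ ω ∂P, ‖(w : Ω → 𝕜) ω‖ * ξ ω ≤ 1) :
    ∀ᵐ ω ∂P, (N (w • x) : Ω → ℝ) ω ≤ r := by
  filter_upwards [hx, hw, N.ae_smul w x] with ω h1 h2 h3
  rw [h3]
  calc _ ≤ ‖(w : Ω → 𝕜) ω‖ * (r * ξ ω) := by gcongr
    _ = r * (‖(w : Ω → 𝕜) ω‖ * ξ ω) := by ring
    _ ≤ r * 1 := by gcongr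
    _ = r := mul_one r

variable [IsProbabilityMeasure P]

/-! ### Functions with derivative zero -/

/-- An `L⁰`-Lipschitz function with derivative zero is constant. -/
theorem eq_of_hasDeriv_zero {N : L0Norm 𝕜 P X} {φ : ℝ≥0 → X} {l : ℝ≥0} (ξ : Ω →ₘ[P] ℝ)
    (hL : ∀ u ≤ l, ∀ v ≤ l,
      ∀ᵐ ω ∂P, (N (φ u - φ v) : Ω → ℝ) ω ≤ |(u : ℝ) - v| * (ξ : Ω → ℝ) ω)
    (hd : ∀ u, 0 < u → u < l → N.HasDeriv φ 0 u) : φ l = φ 0 := by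
  obtain ⟨w, w', hww, -, hw⟩ := exists_normalizer 𝕜 ξ
  rcases eq_or_ne l 0 with rfl | hl0
  · rfl
  have hl : 0 < l := pos_iff_ne_zero.2 hl0
  have hL' : ∀ u ≤ l, ∀ v ≤ l,
      ∀ᵐ ω ∂P, (N (w • φ u - w • φ v) : Ω → ℝ) ω ≤ 1 * |(u : ℝ) - v| := by
    intro u hu v hv
    rw [← smul_sub, one_mul]
    exact ae_le_of_smul (abs_nonneg _) (hL u hu v hv) hw
  -- The derivative is known only at interior points, so the mean value inequality is used on `[s,
  -- l]` with `0 < s`. The Lipschitz bound covers `[0, s]`, and `s` then shrinks to zero.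
  have hzero : ∀ s, 0 < s → s ≤ l → N.meanNorm (w • φ l - w • φ s) ≤ 0 := by
    intro s hs hsl
    have := meanNorm_sub_le_of_slope_le (N := N) (Φ := fun u => w • φ u) hsl (c := 1) (K := 0)
      (fun u hu v hv => hL' u hu.2 v hv.2) ?_
    · simpa using this
    · intro u hu ε hε
      have h := (hasDeriv_smul (hd u (hs.trans_le hu.1) hu.2) w).meanNorm_sub_le zero_le_one ?_ hε
      · filter_upwards [h] with v hv
        simpa [rsmul_eq] using hv
      · filter_upwards [Ioo_mem_nhdsGT hu.2] with v hv
        exact hL' v hv.2.le u hu.2.le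
  have hle : ∀ s, 0 < s → s ≤ l → N.meanNorm (w • φ l - w • φ 0) ≤ s := by
    intro s hs hsl
    have h1 := meanNorm_add_le (isInt_of_ae_le (hL' l le_rfl s hsl))
      (isInt_of_ae_le (hL' s hsl 0 zero_le))
    rw [sub_add_sub_cancel] at h1
    have h2 := meanNorm_le_of_ae_le (hL' s hsl 0 zero_le)
    have h3 : (1 : ℝ) * |(s : ℝ) - (0 : ℝ≥0)| = s := by simp
    rw [h3] at h2
    linarith [hzero s hs hsl]
  have h0 : N.meanNorm (w • φ l - w • φ 0) ≤ 0 := by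
    refine le_of_forall_pos_le_add fun ε hε => ?_
    rw [zero_add]
    refine (hle (min l ε.toNNReal) (lt_min hl (Real.toNNReal_pos.2 hε)) (min_le_left _ _)).trans ?_
    rw [NNReal.coe_min, Real.coe_toNNReal _ hε.le]
    exact min_le_right _ _
  have h1 := eq_zero_of_meanNorm_le_zero (isInt_of_ae_le (hL' l le_rfl 0 zero_le)) h0
  rw [← smul_sub] at h1
  have h2 := congrArg (fun x => w' • x) h1
  simp only [smul_zero, smul_smul, hww, one_smul] at h2
  exact sub_eq_zero.1 h2

/-! ### Primitives and Riemann integrals -/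

/-- The increments of a primitive are the Riemann integrals. -/
theorem hasRiemannIntegral_of_hasDeriv {N : L0Norm 𝕜 P X} {f F : ℝ≥0 → X} (hf : N.IsCont f)
    {l : ℝ≥0} (ξ : Ω →ₘ[P] ℝ)
    (hb : ∀ u ≤ l, ∀ᵐ ω ∂P, (N (f u) : Ω → ℝ) ω ≤ (ξ : Ω → ℝ) ω)
    (hL : ∀ u ≤ l, ∀ v ≤ l,
      ∀ᵐ ω ∂P, (N (F u - F v) : Ω → ℝ) ω ≤ |(u : ℝ) - v| * (ξ : Ω → ℝ) ω)
    (hd : ∀ u < l, N.HasDeriv F (f u) u) {a b : ℝ≥0} (hbl : b ≤ l) :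
    N.HasRiemannIntegral f a b (F b - F a) := by
  obtain ⟨w, w', hww, -, hw⟩ := exists_normalizer 𝕜 ξ
  have hL' : ∀ u ≤ l, ∀ v ≤ l,
      ∀ᵐ ω ∂P, (N (w • F u - w • F v) : Ω → ℝ) ω ≤ 1 * |(u : ℝ) - v| := by
    intro u hu v hv
    rw [← smul_sub, one_mul]
    exact ae_le_of_smul (abs_nonneg _) (hL u hu v hv) hw
  have hb' : ∀ u ≤ l, ∀ᵐ ω ∂P, (N (w • f u) : Ω → ℝ) ω ≤ 1 := fun u hu =>
    ae_le_of_smul zero_le_one ((hb u hu).mono fun ω h => by rwa [one_mul]) hw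
  have hf' : N.IsCont fun u => w • f u :=
    N.isCont_iff.2 fun u => ((N.isCont_iff.1 hf) u).smul w
  have hmain : N.HasRiemannIntegral (fun u => w • f u) a b (w • F b - w • F a) := by
    intro ε hε lam hlam
    have hc : 0 < ε * (1 - lam) := mul_pos hε (by linarith [hlam.2])
    -- Each subinterval will contribute at most this tolerance times its length. Dividing by `b + 1`
    -- leaves the total strictly below the Markov threshold `ε * (1 - lam)`, also when `b = 0`.
    obtain ⟨δ, hδ, hu⟩ := hf'.exists_meanNorm_sub_lt zero_le_one hb'
      (ε := ε * (1 - lam) / (b + 1)) (by positivity)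
    refine ⟨δ, hδ, fun n t τ h0 hn ht => ?_⟩
    have hmono : ∀ i ≤ n, ∀ j ≤ i, t j ≤ t i := by
      intro i
      induction i with
      | zero => intro _ j hj; rw [Nat.le_zero.1 hj]
      | succ i ih =>
        intro hi j hj
        rcases Nat.le_succ_iff.1 hj with h | rfl
        · exact (ih (by omega) j h).trans ((ht i (by omega)).1.trans (ht i (by omega)).2.1)
        · exact le_rfl
    have htb : ∀ i ≤ n, t i ≤ l := fun i hi => (hmono n le_rfl i hi).trans (hn ▸ hbl)
    -- The increment of `F` telescopes over the partition, which reduces the claim to one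
    -- subinterval at a time.
    have hsum : ∑ i ∈ Finset.range n, N.rsmul ((t (i + 1) : ℝ) - t i) (w • f (τ i)) -
        (w • F b - w • F a) = ∑ i ∈ Finset.range n,
          (N.rsmul ((t (i + 1) : ℝ) - t i) (w • f (τ i)) - (w • F (t (i + 1)) - w • F (t i))) := by
      rw [Finset.sum_sub_distrib, Finset.sum_range_sub (fun i => w • F (t i)), hn, h0]
    have hterm : ∀ i < n, N.IsInt (N.rsmul ((t (i + 1) : ℝ) - t i) (w • f (τ i)) -
        (w • F (t (i + 1)) - w • F (t i))) ∧
        N.meanNorm (N.rsmul ((t (i + 1) : ℝ) - t i) (w • f (τ i)) -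
        (w • F (t (i + 1)) - w • F (t i))) ≤
          ε * (1 - lam) / (b + 1) * ((t (i + 1) : ℝ) - t i) := by
      intro i hi
      obtain ⟨h1, h2, h3⟩ := ht i hi
      have h4 : t (i + 1) ≤ l := htb _ hi
      have h1' : (t i : ℝ) ≤ τ i := by exact_mod_cast h1
      have h2' : (τ i : ℝ) ≤ t (i + 1) := by exact_mod_cast h2
      have hτ : τ i ≤ l := h2.trans h4
      refine ⟨((isInt_of_ae_le (hb' _ hτ)).rsmul _).sub
        (isInt_of_ae_le (hL' _ h4 _ (htb i hi.le))), ?_⟩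
      have hΦL : ∀ u ∈ Set.Icc (t i) (t (i + 1)), ∀ v ∈ Set.Icc (t i) (t (i + 1)), ∀ᵐ ω ∂P,
          (N ((w • F u - N.rsmul u (w • f (τ i))) - (w • F v - N.rsmul v (w • f (τ i)))) :
            Ω → ℝ) ω ≤ 2 * |(u : ℝ) - v| := by
        intro u hu v hv
        have e : (w • F u - N.rsmul u (w • f (τ i))) - (w • F v - N.rsmul v (w • f (τ i))) =
            (w • F u - w • F v) - N.rsmul ((u : ℝ) - v) (w • f (τ i)) := by
          rw [sub_rsmul]
          abel
        rw [e]
        filter_upwards [hL' u (hu.2.trans h4) v (hv.2.trans h4), hb' _ hτ,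
          N.ae_rsmul ((u : ℝ) - v) (w • f (τ i)),
          N.ae_sub_le (w • F u - w • F v) (N.rsmul ((u : ℝ) - v) (w • f (τ i)))]
          with ω h5 h6 h7 h8
        have := mul_le_mul_of_nonneg_left h6 (abs_nonneg ((u : ℝ) - v))
        linarith
      -- Subtracting the linear function with slope `w • f (τ i)` leaves the derivative `w • f u - w
      -- • f (τ i)`, small in mean because `u` and the tag are closer than the mesh bound.
      have hmv := meanNorm_sub_le_of_slope_le (N := N)
        (Φ := fun u => w • F u - N.rsmul u (w • f (τ i))) (h1.trans h2) (c := 2)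
        (K := ε * (1 - lam) / (b + 1)) hΦL ?_
      · have e : (w • F (t (i + 1)) - N.rsmul (t (i + 1)) (w • f (τ i))) -
            (w • F (t i) - N.rsmul (t i) (w • f (τ i))) =
            -(N.rsmul ((t (i + 1) : ℝ) - t i) (w • f (τ i)) -
              (w • F (t (i + 1)) - w • F (t i))) := by
          rw [sub_rsmul]
          abel
        rwa [e, meanNorm_neg] at hmv
      · intro u hu' ε' hε'
        have hul : u < l := hu'.2.trans_le h4
        have hder := (hasDeriv_smul (hd u hul) w).meanNorm_sub_le zero_le_one
          (by
            filter_upwards [Ioo_mem_nhdsGT hul] with v hv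
            exact hL' v hv.2.le u hul.le) hε'
        filter_upwards [hder, Ioo_mem_nhdsGT hul] with v hv huv
        have huv' : (0 : ℝ) < (v : ℝ) - u := sub_pos.2 (by exact_mod_cast huv.1)
        have e : (w • F v - N.rsmul v (w • f (τ i))) - (w • F u - N.rsmul u (w • f (τ i))) =
            (w • F v - w • F u - N.rsmul ((v : ℝ) - u) (w • f u)) +
              N.rsmul ((v : ℝ) - u) (w • f u - w • f (τ i)) := by
          rw [sub_rsmul, sub_rsmul, rsmul_sub, rsmul_sub]
          abel
        have hi1 : N.IsInt (w • f u) := isInt_of_ae_le (hb' u hul.le)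
        have hi2 : N.IsInt (w • f u - w • f (τ i)) := hi1.sub (isInt_of_ae_le (hb' _ hτ))
        have h5 := meanNorm_add_le
          ((isInt_of_ae_le (hL' v huv.2.le u hul.le)).sub (hi1.rsmul ((v : ℝ) - u)))
          (hi2.rsmul ((v : ℝ) - u))
        rw [← e, meanNorm_rsmul, abs_of_pos huv'] at h5
        have hu1 : (t i : ℝ) ≤ u := by exact_mod_cast hu'.1
        have hu2 : (u : ℝ) < t (i + 1) := by exact_mod_cast hu'.2
        have h6 := hu u hul.le (τ i) hτ (by rw [abs_lt]; constructor <;> linarith)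
        have h7 := mul_le_mul_of_nonneg_left h6.le huv'.le
        linarith
    obtain ⟨hs1, hs2⟩ := meanNorm_sum_le fun i hi => (hterm i hi).1
    rw [hsum]
    refine mem_basicNhd_of_meanNorm_lt hε hs2 (hs1.trans_lt ?_)
    calc _ ≤ ∑ i ∈ Finset.range n, ε * (1 - lam) / (b + 1) * ((t (i + 1) : ℝ) - t i) :=
          Finset.sum_le_sum fun i hi => (hterm i (Finset.mem_range.1 hi)).2
      _ = ε * (1 - lam) / (b + 1) * ((b : ℝ) - a) := by
          rw [← Finset.mul_sum, Finset.sum_range_sub (fun i => (t i : ℝ)), hn, h0]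
      _ < ε * (1 - lam) / (b + 1) * (b + 1) := by
          have : (0 : ℝ) ≤ a := a.2
          gcongr
          linarith
      _ = ε * (1 - lam) := by
          have : (0 : ℝ) ≤ b := b.2
          field_simp
  -- The inverse factor undoes the normalization.
  have hres := hmain.smul w'
  simp only [← smul_sub, smul_smul, hww, one_smul] at hres
  exact hres

end Primitive

/-! ### Existence of primitives of order bounded continuous functions. -/

section Existence

variable {𝕜 : Type*} [RCLike 𝕜] {Ω : Type*} [MeasurableSpace Ω] {P : Measure Ω}
  {X : Type*} [AddCommGroup X] [Module (Ω →ₘ[P] 𝕜) X]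

/-- The primitive of the step function with value `f (i δ)` on `[i δ, (i + 1) δ)`. -/
theorem exists_step_primitive {N : L0Norm 𝕜 P X} {f : ℝ≥0 → X} {ξ : Ω → ℝ}
    (hb : ∀ u, ∀ᵐ ω ∂P, (N (f u) : Ω → ℝ) ω ≤ ξ ω) {δ : ℝ≥0} (hδ : 0 < δ) (M : ℕ) :
    ∃ G : ℝ≥0 → X, G 0 = 0 ∧
      (∀ u v, ∀ᵐ ω ∂P, (N (G u - G v) : Ω → ℝ) ω ≤ |(u : ℝ) - v| * ξ ω) ∧
      ∀ u < M * δ, ∃ r ≤ u, u < r + δ ∧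
        ∀ᶠ v : ℝ≥0 in 𝓝[>] u, G v - G u = N.rsmul ((v : ℝ) - u) (f r) := by
  -- `a i s` is the length of the part of the `i`-th cell that lies in `[0, s]`.
  let a : ℕ → ℝ≥0 → ℝ := fun i s => (min s ((i + 1 : ℕ) * δ) : ℝ≥0) - (min s (i * δ) : ℝ≥0)
  let G : ℝ≥0 → X := fun s => ∑ i ∈ Finset.range M, N.rsmul (a i s) (f (i * δ))
  have hG : ∀ u v, G u - G v = ∑ i ∈ Finset.range M, N.rsmul (a i u - a i v) (f (i * δ)) := by
    intro u v
    simp only [G, ← Finset.sum_sub_distrib, sub_rsmul]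
  have hξ : ∀ᵐ ω ∂P, 0 ≤ ξ ω := by
    filter_upwards [hb 0, N.ae_nonneg (f 0)] with ω h1 h2
    exact h2.trans h1
  have hle : ∀ i : ℕ, (i : ℝ≥0) * δ ≤ (i + 1 : ℕ) * δ := fun i =>
    mul_le_mul_left (by exact_mod_cast i.le_succ) δ
  have hmono : ∀ i, Monotone (a i) := by
    intro i u v huv
    have h1 := hle i
    simp only [a, NNReal.coe_min]
    have h1' : ((i * δ : ℝ≥0) : ℝ) ≤ ((i + 1 : ℕ) * δ : ℝ≥0) := by exact_mod_cast h1
    have huv' : (u : ℝ) ≤ v := by exact_mod_cast huv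
    grind
  have hmain : ∀ u v, v ≤ u → ∀ᵐ ω ∂P, (N (G u - G v) : Ω → ℝ) ω ≤ |(u : ℝ) - v| * ξ ω := by
    intro u v hvu
    have h1 : ∀ᵐ ω ∂P, (N (G u - G v) : Ω → ℝ) ω ≤
        ∑ i ∈ Finset.range M, (a i u - a i v) * ξ ω := by
      rw [hG]
      refine ae_sum_le fun i _ => ?_
      filter_upwards [N.ae_rsmul (a i u - a i v) (f (i * δ)), hb (i * δ)] with ω h2 h3
      have h4 : 0 ≤ a i u - a i v := sub_nonneg.2 (hmono i hvu)
      rw [h2, abs_of_nonneg h4]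
      exact mul_le_mul_of_nonneg_left h3 h4
    filter_upwards [h1, hξ] with ω h2 h3
    refine h2.trans ?_
    rw [← Finset.sum_mul]
    refine mul_le_mul_of_nonneg_right ?_ h3
    rw [Finset.sum_sub_distrib]
    simp only [a]
    -- The cell lengths telescope to `min u (M * δ) - min v (M * δ)`, which is at most `u - v`.
    rw [Finset.sum_range_sub (fun i : ℕ => ((min u (i * δ) : ℝ≥0) : ℝ)),
      Finset.sum_range_sub (fun i : ℕ => ((min v (i * δ) : ℝ≥0) : ℝ))]
    simp only [Nat.cast_zero, zero_mul, min_zero, NNReal.coe_zero, sub_zero, NNReal.coe_min]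
    have hvu' : (v : ℝ) ≤ u := by exact_mod_cast hvu
    rw [abs_of_nonneg (by linarith)]
    grind
  refine ⟨G, ?_, ?_, ?_⟩
  · simp only [G, a, min_eq_left zero_le, sub_self, zero_rsmul, Finset.sum_const_zero]
  · intro u v
    rcases le_total v u with h | h
    · exact hmain u v h
    · filter_upwards [hmain v u h, N.ae_sub_comm (G u) (G v)] with ω h1 h2
      rwa [h2, abs_sub_comm]
  · intro u hu
    -- `j` is the cell containing `u`. Immediately to the right of `u` only the `j`-th length
    -- changes; on the left this would fail when `u` is a node.
    set j := ⌊u / δ⌋₊ with hj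
    have hj1 : (j : ℝ≥0) * δ ≤ u := by
      rw [← le_div_iff₀ hδ]
      exact Nat.floor_le zero_le
    have hj2 : u < (j + 1 : ℕ) * δ := by
      rw [← div_lt_iff₀ hδ]
      push_cast
      exact Nat.lt_floor_add_one _
    have hjM : j < M := by
      have h1 : (j : ℝ≥0) * δ < M * δ := hj1.trans_lt hu
      exact_mod_cast lt_of_mul_lt_mul_right h1 zero_le
    refine ⟨j * δ, hj1, ?_, ?_⟩
    · calc u < _ := hj2
        _ = _ := by push_cast; ring
    · filter_upwards [Ioo_mem_nhdsGT hj2] with v hv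
      rw [hG, Finset.sum_eq_single j]
      · congr 1
        simp only [a]
        rw [min_eq_left hv.2.le, min_eq_left hj2.le, min_eq_right hj1,
          min_eq_right (hj1.trans hv.1.le)]
        ring
      · intro i _ hij
        have : a i v - a i u = 0 := by
          simp only [a]
          rcases lt_or_gt_of_ne hij with h | h
          · have h1 : ((i + 1 : ℕ) : ℝ≥0) * δ ≤ u :=
              (mul_le_mul_left (by exact_mod_cast h) δ).trans hj1
            rw [min_eq_right h1, min_eq_right (h1.trans hv.1.le),
              min_eq_right ((hle i).trans h1), min_eq_right (((hle i).trans h1).trans hv.1.le)]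
            ring
          · have h1 : v ≤ (i : ℝ≥0) * δ :=
              hv.2.le.trans (mul_le_mul_left (by exact_mod_cast h) δ)
            rw [min_eq_left h1, min_eq_left (hv.1.le.trans h1),
              min_eq_left (h1.trans (hle i)), min_eq_left ((hv.1.le.trans h1).trans (hle i))]
            ring
        rw [this, zero_rsmul]
      · intro h
        exact absurd (Finset.mem_range.2 hjM) h

variable [IsProbabilityMeasure P]

/-- Approximate primitives of a bounded continuous function. -/
theorem exists_approx_primitive {N : L0Norm 𝕜 P X} {f : ℝ≥0 → X} (hf : N.IsCont f) {ξ : Ω → ℝ}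
    (hξ : ∀ᵐ ω ∂P, ξ ω ≤ 1) (hb : ∀ u, ∀ᵐ ω ∂P, (N (f u) : Ω → ℝ) ω ≤ ξ ω) (l : ℝ≥0) {ε : ℝ}
    (hε : 0 < ε) :
    ∃ G : ℝ≥0 → X, G 0 = 0 ∧
      (∀ u v, ∀ᵐ ω ∂P, (N (G u - G v) : Ω → ℝ) ω ≤ |(u : ℝ) - v| * ξ ω) ∧
      ∀ u < l, ∀ᶠ v : ℝ≥0 in 𝓝[>] u,
        N.meanNorm (G v - G u - N.rsmul ((v : ℝ) - u) (f u)) ≤ ε * ((v : ℝ) - u) := by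
  have hb1 : ∀ u, ∀ᵐ ω ∂P, (N (f u) : Ω → ℝ) ω ≤ 1 := by
    intro u
    filter_upwards [hb u, hξ] with ω h1 h2
    exact h1.trans h2
  obtain ⟨δ, hδ, hu⟩ := hf.exists_meanNorm_sub_lt (l := l) zero_le_one (fun u _ => hb1 u) hε
  obtain ⟨M, hM⟩ := exists_nat_ge (l / δ.toNNReal)
  have hδ' : 0 < δ.toNNReal := Real.toNNReal_pos.2 hδ
  obtain ⟨G, h0, hL, hG⟩ := exists_step_primitive hb hδ' M
  refine ⟨G, h0, hL, fun u hul => ?_⟩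
  obtain ⟨r, hr1, hr2, hr⟩ := hG u (hul.trans_le ((div_le_iff₀ hδ').1 hM))
  filter_upwards [hr, self_mem_nhdsWithin] with v hv huv
  have huv' : (0 : ℝ) < (v : ℝ) - u := sub_pos.2 (by exact_mod_cast huv)
  rw [hv, ← rsmul_sub, meanNorm_rsmul, abs_of_pos huv', mul_comm]
  refine mul_le_mul_of_nonneg_right (hu r (hr1.trans hul.le) u hul.le ?_).le huv'.le
  have h1 : (r : ℝ) ≤ u := by exact_mod_cast hr1
  have h2 : (u : ℝ) < r + δ := by
    have : (u : ℝ) < ((r + δ.toNNReal : ℝ≥0) : ℝ) := by exact_mod_cast hr2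
    rwa [NNReal.coe_add, Real.coe_toNNReal _ hδ.le] at this
  rw [abs_lt]
  constructor <;> linarith

/-- The mean value inequality makes the approximate primitives with slope error `1 / (n + 1)`
uniformly Cauchy in mean on `[0, l]`. Their limit keeps the Lipschitz bound and inherits an exact
slope estimate. -/
theorem exists_primitive_of_le_one {N : L0Norm 𝕜 P X} (hX : N.IsComplete) {f : ℝ≥0 → X}
    (hf : N.IsCont f) {ξ : Ω → ℝ} (hξ : ∀ᵐ ω ∂P, ξ ω ≤ 1)
    (hb : ∀ u, ∀ᵐ ω ∂P, (N (f u) : Ω → ℝ) ω ≤ ξ ω) (l : ℝ≥0) :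
    ∃ F : ℝ≥0 → X, F 0 = 0 ∧
      (∀ u v, ∀ᵐ ω ∂P, (N (F u - F v) : Ω → ℝ) ω ≤ |(u : ℝ) - v| * ξ ω) ∧
      ∀ u < l, N.HasDeriv F (f u) u := by
  have hpos : ∀ n : ℕ, (0 : ℝ) < 1 / ((n : ℝ) + 1) := fun n => by positivity
  choose G hG0 hGL hGd using fun n : ℕ => exists_approx_primitive hf hξ hb l (hpos n)
  have hb1 : ∀ u, ∀ᵐ ω ∂P, (N (f u) : Ω → ℝ) ω ≤ 1 := by
    intro u
    filter_upwards [hb u, hξ] with ω h1 h2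
    exact h1.trans h2
  have hGL1 : ∀ n u v, ∀ᵐ ω ∂P, (N (G n u - G n v) : Ω → ℝ) ω ≤ 1 * |(u : ℝ) - v| := by
    intro n u v
    filter_upwards [hGL n u v, hξ] with ω h1 h2
    rw [one_mul]
    exact h1.trans (mul_le_of_le_one_right (abs_nonneg _) h2)
  have hGint : ∀ n u v, N.IsInt (G n u - G n v) := fun n u v => isInt_of_ae_le (hGL1 n u v)
  have hGint0 : ∀ n u, N.IsInt (G n u) := fun n u => by
    have := hGint n u 0
    rwa [hG0, sub_zero] at this
  have hfint : ∀ u, N.IsInt (f u) := fun u => isInt_of_ae_le (hb1 u)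
  have hdiff : ∀ m n, ∀ s ≤ l, N.meanNorm (G m s - G n s) ≤
      (1 / ((m : ℝ) + 1) + 1 / ((n : ℝ) + 1)) * s := by
    intro m n s hs
    have h := meanNorm_sub_le_of_slope_le (N := N) (Φ := fun u => G m u - G n u)
      (s := 0) (t := s) zero_le (c := 2) (K := 1 / ((m : ℝ) + 1) + 1 / ((n : ℝ) + 1)) ?_ ?_
    · simpa [hG0] using h
    · intro u _ v _
      rw [sub_sub_sub_comm]
      filter_upwards [hGL1 m u v, hGL1 n u v, N.ae_sub_le (G m u - G m v) (G n u - G n v)]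
        with ω h1 h2 h3
      linarith
    · intro u hu ε hε
      have hul : u < l := hu.2.trans_le hs
      filter_upwards [hGd m u hul, hGd n u hul, self_mem_nhdsWithin] with v h1 h2 huv
      have huv' : (0 : ℝ) < (v : ℝ) - u := sub_pos.2 (by exact_mod_cast huv)
      have h3 := meanNorm_sub_le ((hGint m v u).sub ((hfint u).rsmul ((v : ℝ) - u)))
        ((hGint n v u).sub ((hfint u).rsmul ((v : ℝ) - u)))
      rw [sub_sub_sub_cancel_right, sub_sub_sub_comm] at h3
      have := mul_pos hε huv'
      linarith
  -- The Cauchy estimate holds only up to `l`, so the limit function is made constant afterwards.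
  have hlim : ∀ s, ∃ x, N.TendsTo (fun n => G n (min s l)) atTop x := by
    intro s
    refine hX _ fun ε hε lam hlam => ?_
    have hc : 0 < ε * (1 - lam) := mul_pos hε (by linarith [hlam.2])
    have ht : Tendsto (fun n : ℕ => 1 / ((n : ℝ) + 1)) atTop (𝓝 0) :=
      tendsto_one_div_add_atTop_nhds_zero_nat
    obtain ⟨n₀, hn₀⟩ := eventually_atTop.1
      (ht.eventually (gt_mem_nhds (show 0 < ε * (1 - lam) / (2 * (l + 1)) by positivity)))
    refine ⟨n₀, fun m hm n hn => ?_⟩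
    refine mem_basicNhd_of_meanNorm_lt hε ((hGint0 m _).sub (hGint0 n _))
      ((hdiff m n _ (min_le_right s l)).trans_lt ?_)
    have h1 := hn₀ m hm
    have h2 := hn₀ n hn
    have h3 : ((min s l : ℝ≥0) : ℝ) ≤ l := by exact_mod_cast min_le_right s l
    calc _ ≤ (ε * (1 - lam) / (2 * (l + 1)) + ε * (1 - lam) / (2 * (l + 1))) * l := by
          gcongr
      _ < (ε * (1 - lam) / (2 * (l + 1)) + ε * (1 - lam) / (2 * (l + 1))) * (l + 1) := by
          gcongr
          linarith
      _ = ε * (1 - lam) := by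
          have : (0 : ℝ) ≤ l := l.2
          field_simp
          ring
  choose F hF using hlim
  have hξ0 : ∀ᵐ ω ∂P, 0 ≤ ξ ω := by
    filter_upwards [hb 0, N.ae_nonneg (f 0)] with ω h1 h2
    exact h2.trans h1
  have hFL : ∀ u v, ∀ᵐ ω ∂P, (N (F u - F v) : Ω → ℝ) ω ≤ |(u : ℝ) - v| * ξ ω := by
    intro u v
    refine ((hF u).sub (hF v)).ae_le (Eventually.of_forall fun n => ?_)
    filter_upwards [hGL n (min u l) (min v l), hξ0] with ω h1 h2
    refine h1.trans (mul_le_mul_of_nonneg_right ?_ h2)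
    rw [NNReal.coe_min, NNReal.coe_min]
    exact abs_inf_sub_inf_le_abs _ _ _
  have hFL1 : ∀ u v, ∀ᵐ ω ∂P, (N (F u - F v) : Ω → ℝ) ω ≤ 1 * |(u : ℝ) - v| := by
    intro u v
    filter_upwards [hFL u v, hξ] with ω h1 h2
    rw [one_mul]
    exact h1.trans (mul_le_of_le_one_right (abs_nonneg _) h2)
  -- The comparison vector `y` need not be a value at the left endpoint: below, `y` is the value at
  -- the point of differentiation, which is the right endpoint for left difference quotients.
  have hest : ∀ u v, u ≤ v → v ≤ l → ∀ y, (∀ᵐ ω ∂P, (N y : Ω → ℝ) ω ≤ 1) → ∀ K,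
      (∀ r ∈ Set.Icc u v, N.meanNorm (f r - y) ≤ K) →
      N.meanNorm (F v - F u - N.rsmul ((v : ℝ) - u) y) ≤ K * ((v : ℝ) - u) := by
    intro u v huv hvl y hy K hK
    have hyint : N.IsInt y := isInt_of_ae_le hy
    have hn : ∀ n, N.meanNorm (G n v - G n u - N.rsmul ((v : ℝ) - u) y) ≤
        (K + 1 / ((n : ℝ) + 1)) * ((v : ℝ) - u) := by
      intro n
      have h := meanNorm_sub_le_of_slope_le (N := N) (Φ := fun r => G n r - N.rsmul r y)
        huv (c := 2) (K := K + 1 / ((n : ℝ) + 1)) ?_ ?_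
      · rwa [sub_sub_sub_comm, ← sub_rsmul] at h
      · intro p _ q _
        rw [sub_sub_sub_comm, ← sub_rsmul]
        filter_upwards [hGL1 n p q, hy, N.ae_rsmul ((p : ℝ) - q) y,
          N.ae_sub_le (G n p - G n q) (N.rsmul ((p : ℝ) - q) y)] with ω h1 h2 h3 h4
        have := mul_le_mul_of_nonneg_left h2 (abs_nonneg ((p : ℝ) - q))
        linarith
      · intro p hp ε hε
        have hpl : p < l := hp.2.trans_le hvl
        filter_upwards [hGd n p hpl, self_mem_nhdsWithin] with q h1 hpq
        have hpq' : (0 : ℝ) < (q : ℝ) - p := sub_pos.2 (by exact_mod_cast hpq)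
        have e : (G n q - N.rsmul q y) - (G n p - N.rsmul p y) =
            (G n q - G n p - N.rsmul ((q : ℝ) - p) (f p)) +
              N.rsmul ((q : ℝ) - p) (f p - y) := by
          rw [rsmul_sub, sub_rsmul (x := y)]
          abel
        have h2 := meanNorm_add_le ((hGint n q p).sub ((hfint p).rsmul ((q : ℝ) - p)))
          (((hfint p).sub hyint).rsmul ((q : ℝ) - p))
        rw [← e, meanNorm_rsmul, abs_of_pos hpq'] at h2
        have h3 := mul_le_mul_of_nonneg_left (hK p ⟨hp.1, hp.2.le⟩) hpq'.le
        have := mul_pos hε hpq'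
        linarith
    have hFl : ∀ s ≤ l, N.TendsTo (fun n => G n s) atTop (F s) := fun s hs => by
      have := hF s
      rwa [min_eq_left hs] at this
    have ht : Tendsto (fun n => N.meanNorm ((G n v - G n u) - (F v - F u))) atTop (𝓝 0) := by
      refine ((hFl v hvl).sub (hFl u (huv.trans hvl))).tendsto_meanNorm
        (c := 2 * |(v : ℝ) - u|) (by positivity) (Eventually.of_forall fun n => ?_)
      filter_upwards [hGL1 n v u, hFL1 v u, N.ae_sub_le (G n v - G n u) (F v - F u)]
        with ω h1 h2 h3
      linarith
    have ht2 : Tendsto (fun n : ℕ => (K + 1 / ((n : ℝ) + 1)) * ((v : ℝ) - u) +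
        N.meanNorm ((G n v - G n u) - (F v - F u))) atTop (𝓝 ((K + 0) * ((v : ℝ) - u) + 0)) :=
      ((tendsto_const_nhds.add tendsto_one_div_add_atTop_nhds_zero_nat).mul_const _).add ht
    rw [add_zero, add_zero] at ht2
    refine ge_of_tendsto' ht2 fun n => ?_
    have h1 := meanNorm_sub_le ((hGint n v u).sub (hyint.rsmul ((v : ℝ) - u)))
      ((hGint n v u).sub (isInt_of_ae_le (hFL1 v u)))
    rw [sub_sub_sub_cancel_left] at h1
    linarith [hn n]
  refine ⟨F, ?_, hFL, fun u hul => ?_⟩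
  · refine (hF 0).unique ?_
    simp only [min_eq_left (zero_le (a := l)), hG0]
    exact N.tendsTo_const 0
  · refine tendsTo_of_tendsto_meanNorm (Eventually.of_forall fun v => ?_) ?_
    · exact ((isInt_of_ae_le (hFL1 v u)).rsmul _).sub (hfint u)
    · rw [Metric.tendsto_nhds]
      intro ε hε
      obtain ⟨δ, hδ, hu⟩ := hf.exists_meanNorm_sub_lt (l := l) zero_le_one (fun u _ => hb1 u)
        (half_pos hε)
      have hnear : ∀ᶠ v : ℝ≥0 in 𝓝[≠] u, dist v u < δ ∧ v < l :=
        nhdsWithin_le_nhds (inter_mem (Metric.ball_mem_nhds u hδ) (Iio_mem_nhds hul))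
      filter_upwards [hnear, self_mem_nhdsWithin] with v hv hne
      rw [NNReal.dist_eq] at hv
      have hne' : (v : ℝ) - u ≠ 0 := sub_ne_zero.2 (by exact_mod_cast hne)
      have hkey : N.meanNorm (F v - F u - N.rsmul ((v : ℝ) - u) (f u)) ≤
          ε / 2 * |(v : ℝ) - u| := by
        rcases le_total u v with huv | huv
        · have huv' : (u : ℝ) ≤ v := by exact_mod_cast huv
          rw [abs_of_nonneg (by linarith)]
          refine hest u v huv hv.2.le _ (hb1 u) _ fun r hr => (hu r (hr.2.trans hv.2.le) u hul.le ?_).le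
          have h1 : (u : ℝ) ≤ r := by exact_mod_cast hr.1
          have h2 : (r : ℝ) ≤ v := by exact_mod_cast hr.2
          have h3 := abs_lt.1 hv.1
          rw [abs_lt]
          constructor <;> linarith
        · have huv' : (v : ℝ) ≤ u := by exact_mod_cast huv
          have h := hest v u huv hul.le _ (hb1 u) (ε / 2) fun r hr =>
            (hu r (hr.2.trans hul.le) u hul.le ?_).le
          · rw [abs_of_nonpos (by linarith), ← N.meanNorm_neg]
            have e : -(F v - F u - N.rsmul ((v : ℝ) - u) (f u)) =
                F u - F v - N.rsmul ((u : ℝ) - v) (f u) := by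
              rw [← neg_sub (u : ℝ) v, neg_rsmul]
              abel
            rwa [e, neg_sub]
          · have h1 : (v : ℝ) ≤ r := by exact_mod_cast hr.1
            have h2 : (r : ℝ) ≤ u := by exact_mod_cast hr.2
            have h3 := abs_lt.1 hv.1
            rw [abs_lt]
            constructor <;> linarith
      have e : N.rsmul ((v : ℝ) - u)⁻¹ (F v - F u) - f u =
          N.rsmul ((v : ℝ) - u)⁻¹ (F v - F u - N.rsmul ((v : ℝ) - u) (f u)) := by
        rw [N.rsmul_sub _ (F v - F u), rsmul_rsmul, inv_mul_cancel₀ hne', one_rsmul]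
      rw [Real.dist_eq, sub_zero, abs_of_nonneg (N.meanNorm_nonneg _), e, meanNorm_rsmul, abs_inv,
        inv_mul_lt_iff₀ (abs_pos.2 hne')]
      have := mul_pos (half_pos hε) (abs_pos.2 hne')
      linarith

/-- A continuous function that is order bounded on `[0, l]` has a primitive there. -/
theorem exists_primitive {N : L0Norm 𝕜 P X} (hX : N.IsComplete) {f : ℝ≥0 → X}
    (hf : N.IsCont f) (ξ : Ω →ₘ[P] ℝ) {l : ℝ≥0}
    (hb : ∀ u ≤ l, ∀ᵐ ω ∂P, (N (f u) : Ω → ℝ) ω ≤ (ξ : Ω → ℝ) ω) :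
    ∃ F : ℝ≥0 → X, F 0 = 0 ∧
      (∀ u v, ∀ᵐ ω ∂P, (N (F u - F v) : Ω → ℝ) ω ≤ |(u : ℝ) - v| * (ξ : Ω → ℝ) ω) ∧
      (∀ u < l, N.HasDeriv F (f u) u) ∧
      ∀ a, ∀ b ≤ l, N.HasRiemannIntegral f a b (F b - F a) := by
  obtain ⟨w, w', hww, hww', hw⟩ := exists_normalizer 𝕜 ξ
  -- `exists_primitive_of_le_one` requires a bound at all times, so `f` is frozen after `l`.
  have hf' : N.IsCont fun u => w • f (min u l) := by
    refine N.isCont_iff.2 fun u => TendsTo.smul w ?_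
    exact Tendsto.comp ((N.isCont_iff.1 hf) (min u l))
      ((continuous_id.min continuous_const).tendsto u)
  obtain ⟨G, hG0, hGL, hGd⟩ := exists_primitive_of_le_one hX hf' hw (fun u => by
    filter_upwards [N.ae_smul w (f (min u l)), hb _ (min_le_right u l)] with ω h1 h2
    rw [h1]
    exact mul_le_mul_of_nonneg_left h2 (norm_nonneg _)) l
  have hL : ∀ u v, ∀ᵐ ω ∂P,
      (N (w' • G u - w' • G v) : Ω → ℝ) ω ≤ |(u : ℝ) - v| * (ξ : Ω → ℝ) ω := by
    intro u v
    rw [← smul_sub]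
    filter_upwards [N.ae_smul w' (G u - G v), hGL u v, hww'] with ω h1 h2 h3
    rw [h1]
    calc _ ≤ ‖(w' : Ω → 𝕜) ω‖ * (|(u : ℝ) - v| * (‖(w : Ω → 𝕜) ω‖ * (ξ : Ω → ℝ) ω)) := by gcongr
      _ = (‖(w' : Ω → 𝕜) ω‖ * ‖(w : Ω → 𝕜) ω‖) * (|(u : ℝ) - v| * (ξ : Ω → ℝ) ω) := by ring
      _ = _ := by rw [h3, one_mul]
  have hd : ∀ u < l, N.HasDeriv (fun u => w' • G u) (f u) u := by
    intro u hu
    have h := hasDeriv_smul (hGd u hu) w'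
    simpa only [smul_smul, hww, one_smul, min_eq_left hu.le] using h
  exact ⟨fun u => w' • G u, by simp only [hG0, smul_zero], hL, hd, fun a b hbl =>
    hasRiemannIntegral_of_hasDeriv hf ξ hb (fun u _ v _ => hL u v) hd hbl⟩

end Existence

/-! ### Generators of locally a.s. bounded `C`-semigroups, existence families and uniqueness. -/

section Semigroup

variable {𝕜 : Type*} [RCLike 𝕜] {Ω : Type*} [MeasurableSpace Ω] {P : Measure Ω}
  {X : Type*} [AddCommGroup X] [Module (Ω →ₘ[P] 𝕜) X]

/-! ### `L⁰`-Lipschitz functions on an interval -/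

/-- `F` is `L⁰`-Lipschitz on `[0, l]`. -/
def LipOn (N : L0Norm 𝕜 P X) (l : ℝ≥0) (F : ℝ≥0 → X) : Prop :=
  ∃ ξ : Ω →ₘ[P] ℝ, ∀ u ≤ l, ∀ v ≤ l,
    ∀ᵐ ω ∂P, (N (F u - F v) : Ω → ℝ) ω ≤ |(u : ℝ) - v| * (ξ : Ω → ℝ) ω

theorem LipOn.sub {N : L0Norm 𝕜 P X} {l : ℝ≥0} {F G : ℝ≥0 → X} (hF : N.LipOn l F)
    (hG : N.LipOn l G) : N.LipOn l fun u => F u - G u := by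
  obtain ⟨ξ, hξ⟩ := hF
  obtain ⟨ζ, hζ⟩ := hG
  refine ⟨ξ + ζ, fun u hu v hv => ?_⟩
  rw [sub_sub_sub_comm]
  filter_upwards [hξ u hu v hv, hζ u hu v hv, N.ae_sub_le (F u - F v) (G u - G v),
    AEEqFun.coeFn_add ξ ζ] with ω h1 h2 h3 h4
  rw [h4, Pi.add_apply, mul_add]
  linarith

theorem LipOn.map {N : L0Norm 𝕜 P X} {l : ℝ≥0} {F : ℝ≥0 → X} (hF : N.LipOn l F)
    {T : X →ₗ[Ω →ₘ[P] 𝕜] X} (hT : N.IsASBounded T) : N.LipOn l fun u => T (F u) := by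
  obtain ⟨ξ, hξ⟩ := hF
  obtain ⟨η, hη⟩ := hT
  refine ⟨η * ξ, fun u hu v hv => ?_⟩
  rw [← _root_.map_sub]
  filter_upwards [hξ u hu v hv, ae_le_of_mem_bounds hη (F u - F v), ae_nonneg_of_mem_bounds hη,
    AEEqFun.coeFn_mul η ξ] with ω h1 h2 h3 h4
  rw [h4, Pi.mul_apply, mul_left_comm]
  exact h2.trans (mul_le_mul_of_nonneg_left h1 h3)

theorem LipOn.rsmul {N : L0Norm 𝕜 P X} {l : ℝ≥0} {F : ℝ≥0 → X} (hF : N.LipOn l F) (r : ℝ) :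
    N.LipOn l fun u => N.rsmul r (F u) := by
  obtain ⟨ξ, hξ⟩ := hF
  refine ⟨|r| • ξ, fun u hu v hv => ?_⟩
  rw [← rsmul_sub]
  filter_upwards [hξ u hu v hv, N.ae_rsmul r (F u - F v), AEEqFun.coeFn_smul |r| ξ] with ω h1 h2 h4
  rw [h4, Pi.smul_apply, smul_eq_mul, h2, mul_left_comm]
  exact mul_le_mul_of_nonneg_left h1 (abs_nonneg r)

theorem LocallyL0Lipschitz.lipOn {N : L0Norm 𝕜 P X} {F : ℝ≥0 → X} (hF : N.LocallyL0Lipschitz F)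
    {l : ℝ≥0} (hl : 0 < l) : N.LipOn l F := by
  obtain ⟨ξ, -, h⟩ := hF l hl
  refine ⟨ξ, fun u hu v hv => ?_⟩
  filter_upwards [AEEqFun.coeFn_le.2 (h u ⟨zero_le, hu⟩ v ⟨zero_le, hv⟩),
    AEEqFun.coeFn_smul |(u : ℝ) - v| ξ] with ω h1 h2
  rwa [h2, Pi.smul_apply, smul_eq_mul] at h1

theorem LocallyASBounded.exists_mem_bounds {N : L0Norm 𝕜 P X}
    {V : ℝ≥0 → X →ₗ[Ω →ₘ[P] 𝕜] X} (hVb : N.LocallyASBounded V) (l : ℝ≥0) :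
    ∃ η : Ω →ₘ[P] ℝ, ∀ s ≤ l, η ∈ N.bounds (V s) := by
  -- Local boundedness speaks of intervals of positive length only; `l + 1` also covers `l = 0`.
  obtain ⟨η, h⟩ := hVb (l + 1) (by positivity)
  exact ⟨η, fun s hs => h s ⟨zero_le, hs.trans (by simp)⟩⟩

theorem ae_le_mul {N : L0Norm 𝕜 P X} {η : Ω →ₘ[P] ℝ} {T : X →ₗ[Ω →ₘ[P] 𝕜] X}
    (h : η ∈ N.bounds T) (x : X) :
    ∀ᵐ ω ∂P, (N (T x) : Ω → ℝ) ω ≤ (η * N x : Ω →ₘ[P] ℝ) ω :=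
  AEEqFun.coeFn_le.2 (h.2 x)

variable [IsProbabilityMeasure P]

/-! ### Reparametrization of derivatives -/

theorem HasDeriv.comp_add {N : L0Norm 𝕜 P X} {F : ℝ≥0 → X} {y : X} {u h : ℝ≥0}
    (hF : N.HasDeriv F y (u + h)) : N.HasDeriv (fun v => F (v + h)) y u := by
  have ht : Tendsto (fun v : ℝ≥0 => v + h) (𝓝[≠] u) (𝓝[≠] (u + h)) := by
    refine tendsto_nhdsWithin_iff.2 ⟨(Continuous.tendsto (by fun_prop) u).mono_left
      nhdsWithin_le_nhds, ?_⟩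
    filter_upwards [self_mem_nhdsWithin] with v hv
    exact fun h' => hv (add_right_cancel h')
  refine TendsTo.congr' (Tendsto.comp hF ht) (Eventually.of_forall fun v => ?_)
  simp only [Function.comp_apply, NNReal.coe_add, add_sub_add_right_eq_sub]

theorem HasDeriv.tendsTo_right {N : L0Norm 𝕜 P X} {F : ℝ≥0 → X} {y : X} {u : ℝ≥0}
    (hF : N.HasDeriv F y u) :
    N.TendsTo (fun h : ℝ≥0 => N.rsmul (h : ℝ)⁻¹ (F (u + h) - F u)) (𝓝[>] 0) y := by
  have ht : Tendsto (fun h : ℝ≥0 => u + h) (𝓝[>] 0) (𝓝[≠] u) := by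
    refine tendsto_nhdsWithin_iff.2 ⟨?_, ?_⟩
    · have : Tendsto (fun h : ℝ≥0 => u + h) (𝓝 0) (𝓝 (u + 0)) :=
        Continuous.tendsto (by fun_prop) 0
      rw [add_zero] at this
      exact this.mono_left nhdsWithin_le_nhds
    · filter_upwards [self_mem_nhdsWithin] with h hh
      exact (lt_add_of_pos_right u hh).ne'
  refine TendsTo.congr' (Tendsto.comp hF ht) (Eventually.of_forall fun v => ?_)
  simp only [Function.comp_apply, NNReal.coe_add, add_sub_cancel_left]

/-- Chain rule for time reversal, one half of the product rule in `eq_zero_of_hasDeriv`. Subtraction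
in `ℝ≥0` is truncated, so `u < l` is needed for the reversal to be injective near `u`. -/
theorem HasDeriv.tendsTo_comp_sub {N : L0Norm 𝕜 P X} {F : ℝ≥0 → X} {y : X} {l u : ℝ≥0}
    (hul : u < l) (hF : N.HasDeriv F y (l - u)) :
    N.TendsTo (fun t : ℝ≥0 => N.rsmul ((t : ℝ) - u)⁻¹ (F (l - t) - F (l - u))) (𝓝[≠] u) (-y) := by
  have hlt : ∀ᶠ t in 𝓝[≠] u, t < l := nhdsWithin_le_nhds (Iio_mem_nhds hul)
  have ht : Tendsto (fun t : ℝ≥0 => l - t) (𝓝[≠] u) (𝓝[≠] (l - u)) := by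
    refine tendsto_nhdsWithin_iff.2 ⟨(Continuous.tendsto (by fun_prop) u).mono_left
      nhdsWithin_le_nhds, ?_⟩
    filter_upwards [self_mem_nhdsWithin, hlt] with t h1 h2 h3
    exact h1 ((tsub_right_inj h2.le hul.le).1 h3)
  refine TendsTo.congr' (TendsTo.neg (Tendsto.comp hF ht)) ?_
  filter_upwards [hlt] with t h2
  simp only [Function.comp_apply]
  rw [NNReal.coe_sub h2.le, NNReal.coe_sub hul.le, sub_sub_sub_cancel_left, ← neg_sub (t : ℝ) u,
    inv_neg, neg_rsmul, neg_neg]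

/-! ### The generator of a locally a.s. bounded `C`-semigroup -/

variable {N : L0Norm 𝕜 P X} {C : X →ₗ[Ω →ₘ[P] 𝕜] X} {V : ℝ≥0 → X →ₗ[Ω →ₘ[P] 𝕜] X}

theorem IsCSemigroup.comm_C (hV : N.IsCSemigroup C V) (s : ℝ≥0) (z : X) :
    V s (C z) = C (V s z) := by
  have h := hV.map_add s 0 z
  rwa [add_zero, hV.map_zero, eq_comm] at h

theorem IsCSemigroup.comm (hV : N.IsCSemigroup C V) (s t : ℝ≥0) (z : X) :
    V s (V t z) = V t (V s z) := by
  rw [← hV.map_add, ← hV.map_add, add_comm]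

/-- In $V(r)x=V(r)(x-x_0)+V(r)x_0$ the local bound makes the first term vanish in the limit, and
strong continuity handles the second. -/
theorem TendsTo.apply_family (hVb : N.LocallyASBounded V) (hc : ∀ z, N.IsCont fun s => V s z)
    {ι : Type*} {l : Filter ι} {r : ι → ℝ≥0} {r₀ : ℝ≥0} (hr : Tendsto r l (𝓝 r₀)) {x : ι → X}
    {x₀ : X} (hx : N.TendsTo x l x₀) : N.TendsTo (fun i => V (r i) (x i)) l (V r₀ x₀) := by
  obtain ⟨η, hη⟩ := hVb.exists_mem_bounds (r₀ + 1)
  have hlt : ∀ᶠ i in l, r i < r₀ + 1 := hr.eventually (gt_mem_nhds (by simp))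
  have h1 : N.TendsTo (fun i => V (r i) (x i - x₀)) l 0 := by
    refine hx.of_ae_le η ?_
    filter_upwards [hlt] with i hi
    rw [sub_zero]
    exact ae_le_of_mem_bounds (hη _ hi.le) _
  have h2 : N.TendsTo (fun i => V (r i) x₀) l (V r₀ x₀) :=
    Tendsto.comp ((N.isCont_iff.1 (hc x₀)) r₀) hr
  have h3 := h1.add h2
  rw [zero_add] at h3
  refine h3.congr' (Eventually.of_forall fun i => ?_)
  simp only [_root_.map_sub, sub_add_cancel]

/-- `V s` commutes with `C` and every `V t`, hence with the difference quotients, and it is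
continuous. -/
theorem IsCSemigroup.apply_mem_graph (hV : N.IsCSemigroup C V) {z y : X}
    (h : (z, y) ∈ (N.generator C V).graph) (s : ℝ≥0) :
    (V s z, V s y) ∈ (N.generator C V).graph := by
  rw [mem_graph_generator N hV.injective_C] at *
  have h1 := h.map (hV.bounded s)
  rw [hV.comm_C] at h1
  refine h1.congr' (Eventually.of_forall fun t => ?_)
  simp only [map_rsmul, _root_.map_sub]
  rw [hV.comm s t, hV.comm_C]

/-- The function $u\mapsto V(h)F(u)-CF(u+h)$ has zero derivative, since $V(h)V(u)=CV(u+h)$. Its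
values at $0$ and $s$ are compared. -/
theorem IsCSemigroup.apply_primitive (hV : N.IsCSemigroup C V) {z : X} {l : ℝ≥0} {F : ℝ≥0 → X}
    {ξ : Ω →ₘ[P] ℝ} (h0 : F 0 = 0)
    (hL : ∀ u v, ∀ᵐ ω ∂P, (N (F u - F v) : Ω → ℝ) ω ≤ |(u : ℝ) - v| * (ξ : Ω → ℝ) ω)
    (hd : ∀ u < l, N.HasDeriv F (V u z) u) {s h : ℝ≥0} (hs : s + h ≤ l) :
    V h (F s) = C (F (s + h)) - C (F h) := by
  have hlip : N.LipOn s F := ⟨ξ, fun u _ v _ => hL u v⟩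
  have hlip' : N.LipOn s fun u => F (u + h) := by
    refine ⟨ξ, fun u _ v _ => ?_⟩
    have := hL (u + h) (v + h)
    simpa only [NNReal.coe_add, add_sub_add_right_eq_sub] using this
  obtain ⟨ζ, hζ⟩ := (hlip.map (hV.bounded h)).sub (hlip'.map hV.bounded_C)
  have key := eq_of_hasDeriv_zero ζ hζ fun u _ hus => by
    have huh : u + h < l := (add_lt_add_left hus h).trans_le hs
    have h1 := hasDeriv_sub (hasDeriv_map (hd u (le_self_add.trans_lt huh)) (hV.bounded h))
      (hasDeriv_map (hd (u + h) huh).comp_add hV.bounded_C)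
    rwa [add_comm u h, hV.map_add, sub_self] at h1
  simp only [h0, _root_.map_zero, zero_add, zero_sub] at key
  rw [sub_eq_iff_eq_add.1 key]
  abel

/-- By `apply_primitive`, $V(h)F(s)-CF(s)$ is $C$ applied to $(F(s+h)-F(s))-(F(h)-F(0))$, and both
increments have known right derivatives. The strict inequality leaves room for $s+h\le l$. -/
theorem IsCSemigroup.primitive_mem_graph (hV : N.IsCSemigroup C V) {z : X} {l : ℝ≥0}
    {F : ℝ≥0 → X} {ξ : Ω →ₘ[P] ℝ} (h0 : F 0 = 0)
    (hL : ∀ u v, ∀ᵐ ω ∂P, (N (F u - F v) : Ω → ℝ) ω ≤ |(u : ℝ) - v| * (ξ : Ω → ℝ) ω)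
    (hd : ∀ u < l, N.HasDeriv F (V u z) u) {s : ℝ≥0} (hs : s < l) :
    (F s, V s z - C z) ∈ (N.generator C V).graph := by
  rw [mem_graph_generator N hV.injective_C]
  have hz : N.HasDeriv F (C z) 0 := by
    have := hd 0 (zero_le.trans_lt hs)
    rwa [hV.map_zero] at this
  refine (((hd s hs).tendsTo_right.sub hz.tendsTo_right).map hV.bounded_C).congr' ?_
  filter_upwards [Ioo_mem_nhdsGT (tsub_pos_of_lt hs)] with h hh
  rw [hV.apply_primitive h0 hL hd (add_comm s h ▸ (lt_tsub_iff_right.1 hh.2).le), ← rsmul_sub,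
    map_rsmul]
  simp only [zero_add, h0, sub_zero, _root_.map_sub]
  congr 1
  abel

/-- The difference quotient of the integrated orbit of `z` is the integrated orbit of the difference
quotient of `z`, and the latter is `C y` plus an error `x h` tending to zero. Letting `h` tend to
zero gives `C (Y s) = C (V s z - C z)`, and `C` is injective. -/
theorem IsCSemigroup.primitive_eq (hV : N.IsCSemigroup C V) (hVb : N.LocallyASBounded V)
    (hX : N.IsComplete) {z y : X} (hzy : (z, y) ∈ (N.generator C V).graph) {l : ℝ≥0}
    {Y : ℝ≥0 → X} {ζ : Ω →ₘ[P] ℝ} (h0 : Y 0 = 0)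
    (hL : ∀ u v, ∀ᵐ ω ∂P, (N (Y u - Y v) : Ω → ℝ) ω ≤ |(u : ℝ) - v| * (ζ : Ω → ℝ) ω)
    (hd : ∀ u < l, N.HasDeriv Y (V u y) u) {s : ℝ≥0} (hs : s < l) :
    Y s = V s z - C z := by
  obtain ⟨η, hη⟩ := hVb.exists_mem_bounds l
  have hprim := fun x : X => exists_primitive hX (hV.cont x) (η * N x) (l := l)
    fun u hu => ae_le_mul (hη u hu) x
  choose F hF0 hFL hFd _ using hprim
  have hlip : ∀ x, N.LipOn s (F x) := fun x => ⟨_, fun u _ v _ => hFL x u v⟩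
  let x : ℝ≥0 → X := fun h => N.rsmul (h : ℝ)⁻¹ (V h z - C z) - C y
  have hx : N.TendsTo x (𝓝[>] 0) 0 := by
    have h1 := ((mem_graph_generator N hV.injective_C V z y).1 hzy).sub (N.tendsTo_const (C y))
    rwa [sub_self] at h1
  have key : ∀ h : ℝ≥0, N.rsmul (h : ℝ)⁻¹ (V h (F z s) - C (F z s)) - C (Y s) = F (x h) s := by
    intro h
    obtain ⟨κ, hκ⟩ := (((((hlip z).map (hV.bounded h)).sub
      ((hlip z).map hV.bounded_C)).rsmul (h : ℝ)⁻¹).sub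
      (LipOn.map ⟨ζ, fun u _ v _ => hL u v⟩ hV.bounded_C)).sub (hlip (x h))
    have h1 := eq_of_hasDeriv_zero κ hκ fun u _ hus => by
      have hul : u < l := hus.trans hs
      have h2 := hasDeriv_sub (hasDeriv_sub (hasDeriv_smul (hasDeriv_sub
        (hasDeriv_map (hFd z u hul) (hV.bounded h)) (hasDeriv_map (hFd z u hul) hV.bounded_C))
        (realHom 𝕜 P (h : ℝ)⁻¹)) (hasDeriv_map (hd u hul) hV.bounded_C)) (hFd (x h) u hul)
      have h3 : realHom 𝕜 P (h : ℝ)⁻¹ • (V h (V u z) - C (V u z)) - C (V u y) - V u (x h) = 0 := by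
        simp only [x, _root_.map_sub (V u), map_rsmul]
        rw [hV.comm h u, hV.comm_C, hV.comm_C, rsmul_eq]
        abel
      rw [h3] at h2
      exact h2
    have h4 : N.rsmul (h : ℝ)⁻¹ (0 : X) = 0 := by rw [rsmul_eq, smul_zero]
    simp only [hF0, h0, _root_.map_zero, sub_zero, h4] at h1
    exact sub_eq_zero.1 h1
  -- The primitive of the orbit of `x h` has Lipschitz constant `η * N (x h)`, so the integrated
  -- error at `s` is at most `s * η * N (x h)`.
  have hlim0 : N.TendsTo (fun h => F (x h) s) (𝓝[>] 0) 0 := by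
    refine hx.of_ae_le ((s : ℝ) • η) (Eventually.of_forall fun h => ?_)
    filter_upwards [hFL (x h) s 0, AEEqFun.coeFn_smul (s : ℝ) η, AEEqFun.coeFn_mul η (N (x h))]
      with ω h1 h2 h3
    rw [hF0, h3, NNReal.coe_zero, sub_zero, sub_zero, NNReal.abs_eq] at h1
    rw [sub_zero, sub_zero, h2, Pi.smul_apply, smul_eq_mul, mul_assoc]
    exact h1
  have hlim := (mem_graph_generator N hV.injective_C V _ _).1
    (hV.primitive_mem_graph (hF0 z) (hFL z) (hFd z) hs)
  have h5 := hlim.sub hlim0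
  simp only [← key, sub_sub_cancel, sub_zero] at h5
  exact hV.injective_C ((N.tendsTo_const (l := 𝓝[>] (0 : ℝ≥0)) (C (Y s))).unique h5)

/-- On the graph of the generator, `V(s) z - C z` is the integral of `V(u) A z`, so that the
orbits are `L⁰`-Lipschitz and differentiable. -/
theorem IsCSemigroup.orbit (hV : N.IsCSemigroup C V) (hVb : N.LocallyASBounded V)
    (hX : N.IsComplete) {z y : X} (hzy : (z, y) ∈ (N.generator C V).graph) {l : ℝ≥0}
    {η : Ω →ₘ[P] ℝ} (hη : ∀ s ≤ l, η ∈ N.bounds (V s)) :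
    (∀ s < l, N.HasRiemannIntegral (fun u => V u y) 0 s (V s z - C z)) ∧
    (∀ s < l, N.HasDeriv (fun u => V u z) (V s y) s) ∧
    ∀ s < l, ∀ t < l, ∀ᵐ ω ∂P,
      (N (V s z - V t z) : Ω → ℝ) ω ≤ |(s : ℝ) - t| * (η * N y : Ω →ₘ[P] ℝ) ω := by
  obtain ⟨Y, h0, hL, hd, hI⟩ := exists_primitive hX (hV.cont y) (η * N y)
    fun u hu => ae_le_mul (hη u hu) y
  have hY : ∀ s < l, Y s = V s z - C z := fun s hs => hV.primitive_eq hVb hX hzy h0 hL hd hs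
  refine ⟨fun s hs => ?_, fun s hs => ?_, fun s hs t ht => ?_⟩
  · have := hI 0 s hs.le
    rwa [h0, sub_zero, hY s hs] at this
  · have hev : ∀ᶠ u in 𝓝 s, Y u = V u z - C z := by
      filter_upwards [Iio_mem_nhds hs] with u hu
      exact hY u hu
    have h1 : N.HasDeriv (fun u => V u z - C z) (V s y) s := hasDeriv_congr (hd s hs) hev
    refine TendsTo.congr' h1 (Eventually.of_forall fun t => ?_)
    simp only [sub_sub_sub_cancel_right]
  · have := hL s t
    rwa [hY s hs, hY t ht, sub_sub_sub_cancel_right] at this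

/-- Uniqueness for the abstract Cauchy problem with zero initial value. -/
theorem IsCSemigroup.eq_zero_of_hasDeriv (hV : N.IsCSemigroup C V) (hVb : N.LocallyASBounded V)
    (hX : N.IsComplete) {U B : ℝ≥0 → X} {l : ℝ≥0} (h0 : U 0 = 0)
    (hg : ∀ u ≤ l, (U u, B u) ∈ (N.generator C V).graph) (ξ : Ω →ₘ[P] ℝ)
    (hL : ∀ u ≤ l, ∀ v ≤ l,
      ∀ᵐ ω ∂P, (N (U u - U v) : Ω → ℝ) ω ≤ |(u : ℝ) - v| * (ξ : Ω → ℝ) ω)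
    (hB : ∀ u ≤ l, ∀ᵐ ω ∂P, (N (B u) : Ω → ℝ) ω ≤ (ξ : Ω → ℝ) ω)
    (hd : ∀ u, 0 < u → u < l → N.HasDeriv U (B u) u) : U l = 0 := by
  -- `orbit` gives information strictly before the endpoint, while the reversed time `l - u` equals
  -- `l` at `u = 0`.
  obtain ⟨η, hη⟩ := hVb.exists_mem_bounds (l + 1)
  have hlt : ∀ u, l - u < l + 1 := fun u => tsub_le_self.trans_lt (by simp)
  have key := eq_of_hasDeriv_zero (N := N) (φ := fun u => V (l - u) (U u)) (l := l)
    (η * ξ + η * ξ) ?_ ?_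
  · simp only [tsub_self, hV.map_zero, h0, _root_.map_zero] at key
    exact hV.injective_C (key.trans (_root_.map_zero C).symm)
  · intro u hu v hv
    -- One copy of `η * ξ` bounds the change of `U` under a fixed operator; the other bounds the
    -- orbit of the fixed vector `U v`, whose Lipschitz constant is `η * N (B v)`.
    have e : V (l - u) (U u) - V (l - v) (U v) =
        V (l - u) (U u - U v) + (V (l - u) (U v) - V (l - v) (U v)) := by
      rw [_root_.map_sub]
      abel
    rw [e]
    filter_upwards [N.ae_add_le (V (l - u) (U u - U v)) (V (l - u) (U v) - V (l - v) (U v)),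
      ae_le_of_mem_bounds (hη _ (hlt u).le) (U u - U v),
      (hV.orbit hVb hX (hg v hv) hη).2.2 _ (hlt u) _ (hlt v), hL u hu v hv, hB v hv,
      ae_nonneg_of_mem_bounds (hη _ (hlt u).le), AEEqFun.coeFn_mul η ξ,
      AEEqFun.coeFn_mul η (N (B v)), AEEqFun.coeFn_add (η * ξ) (η * ξ)]
      with ω h1 h2 h3 h4 h5 h6 h7 h8 h9
    rw [NNReal.coe_sub hu, NNReal.coe_sub hv, sub_sub_sub_cancel_left, abs_sub_comm, h8,
      Pi.mul_apply] at h3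
    rw [h9, Pi.add_apply, h7, Pi.mul_apply]
    have h10 := mul_le_mul_of_nonneg_left h4 h6
    have h11 := mul_le_mul_of_nonneg_left (mul_le_mul_of_nonneg_left h5 h6)
      (abs_nonneg ((u : ℝ) - v))
    linarith
  · intro u hu hul
    -- Product rule: varying `U` contributes `V (l - u) (B u)`, and varying the time of the operator
    -- contributes its negative.
    have h1 : N.TendsTo (fun t : ℝ≥0 => V (l - t) (N.rsmul ((t : ℝ) - u)⁻¹ (U t - U u))) (𝓝[≠] u)
        (V (l - u) (B u)) := by
      refine TendsTo.apply_family hVb hV.cont ?_ (hd u hu hul)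
      exact (Continuous.tendsto (by fun_prop) u).mono_left nhdsWithin_le_nhds
    have h2 := HasDeriv.tendsTo_comp_sub hul
      ((hV.orbit hVb hX (hg u hul.le) hη).2.1 (l - u) (hlt u))
    have h3 := h1.add h2
    rw [add_neg_cancel] at h3
    refine h3.congr' (Eventually.of_forall fun t => ?_)
    simp only [map_rsmul]
    simp only [rsmul_eq, ← smul_add, _root_.map_sub]
    congr 1
    abel

/-! ### The graph norm -/

/-- Each summand is below the graph norm. Conversely, a graph norm of at least `ε` forces one
summand to be at least `ε / 2`, and the level `(1 + lam) / 2` halves each exceptional probability.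
-/
theorem tendsTo_graphNorm_iff {A : X →ₗ.[Ω →ₘ[P] 𝕜] X} {ι : Type*} {l : Filter ι}
    {f : ι → A.domain} {x : A.domain} :
    (N.graphNorm A).TendsTo f l x ↔
      N.TendsTo (fun i => (f i : X)) l x ∧ N.TendsTo (fun i => A (f i)) l (A x) := by
  have hcoe : ∀ z : A.domain, ∀ᵐ ω ∂P, ((N.graphNorm A) z : Ω → ℝ) ω =
      (N (z : X) : Ω → ℝ) ω + (N (A z) : Ω → ℝ) ω := fun z =>
    AEEqFun.coeFn_add (N (z : X)) (N (A z))
  have hmono : ∀ (z : A.domain) (w : X) (ε lam : ℝ), z ∈ (N.graphNorm A).basicNhd ε lam →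
      (∀ᵐ ω ∂P, (N w : Ω → ℝ) ω ≤ ((N.graphNorm A) z : Ω → ℝ) ω) → w ∈ N.basicNhd ε lam := by
    intro z w ε lam hz h
    rw [mem_basicNhd_iff] at *
    refine lt_of_le_of_lt (ENNReal.toReal_mono (measure_ne_top _ _) (measure_mono_ae ?_)) hz
    filter_upwards [h] with ω h1 h2
    exact le_trans (show ε ≤ (N w : Ω → ℝ) ω from h2) h1
  simp only [tendsTo_iff, ← LinearPMap.map_sub, ← Submodule.coe_sub]
  constructor
  · intro h
    refine ⟨fun ε hε lam hlam => (h ε hε lam hlam).mono fun i hi => hmono _ _ _ _ hi ?_,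
      fun ε hε lam hlam => (h ε hε lam hlam).mono fun i hi => hmono _ _ _ _ hi ?_⟩
    · filter_upwards [hcoe (f i - x), N.ae_nonneg (A (f i - x))] with ω h1 h2
      linarith
    · filter_upwards [hcoe (f i - x), N.ae_nonneg ((f i - x : A.domain) : X)] with ω h1 h2
      linarith
  · rintro ⟨h1, h2⟩ ε hε lam hlam
    have hl : (1 + lam) / 2 ∈ Set.Ioo (0 : ℝ) 1 := ⟨by linarith [hlam.1], by linarith [hlam.2]⟩
    filter_upwards [h1 (ε / 2) (by positivity) _ hl, h2 (ε / 2) (by positivity) _ hl] with i h3 h4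
    rw [mem_basicNhd_iff] at *
    have h5 := measureReal_union_le (μ := P) {ω | ε / 2 ≤ (N ((f i - x : A.domain) : X) : Ω → ℝ) ω}
      {ω | ε / 2 ≤ (N (A (f i - x)) : Ω → ℝ) ω}
    have h6 : P.real {ω | ε ≤ ((N.graphNorm A) (f i - x) : Ω → ℝ) ω} ≤
        P.real ({ω | ε / 2 ≤ (N ((f i - x : A.domain) : X) : Ω → ℝ) ω} ∪
          {ω | ε / 2 ≤ (N (A (f i - x)) : Ω → ℝ) ω}) := by
      refine ENNReal.toReal_mono (measure_ne_top _ _) (measure_mono_ae ?_)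
      filter_upwards [hcoe (f i - x)] with ω h7 h8
      have h8' : ε ≤ ((N.graphNorm A) (f i - x) : Ω → ℝ) ω := h8
      rw [h7] at h8'
      change ε / 2 ≤ (N ((f i - x : A.domain) : X) : Ω → ℝ) ω ∨
        ε / 2 ≤ (N (A (f i - x)) : Ω → ℝ) ω
      by_contra! h9
      linarith
    linarith

/-! ### Existence and uniqueness -/

theorem IsCSemigroup.isMildExistenceFamily (hV : N.IsCSemigroup C V)
    (hVb : N.LocallyASBounded V) (hX : N.IsComplete) :
    N.IsMildExistenceFamily (N.generator C V) C V := by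
  refine ⟨hV.bounded_C, hVb, hV.cont, fun z s => ?_⟩
  obtain ⟨η, hη⟩ := hVb.exists_mem_bounds (s + 1)
  obtain ⟨F, h0, hL, hd, hI⟩ := exists_primitive hX (hV.cont z) (η * N z)
    fun u hu => ae_le_mul (hη u hu) z
  have hs : s < s + 1 := by simp
  obtain ⟨y, hy, hy'⟩ := (LinearPMap.mem_graph_iff _).1 (hV.primitive_mem_graph h0 hL hd hs)
  refine ⟨y, ?_, hy'⟩
  have := hI 0 s hs.le
  rw [h0, sub_zero] at this
  rw [hy]
  exact this

/-- On the domain `A` commutes with `V s`, so boundedness and continuity for the graph norm are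
those of `V` at `z` and at `A z`; the integral identity comes from `orbit`. -/
theorem IsCSemigroup.isStrongExistenceFamily (hV : N.IsCSemigroup C V)
    (hVb : N.LocallyASBounded V) (hX : N.IsComplete) :
    N.IsStrongExistenceFamily (N.generator C V) C V := by
  have hg : ∀ (s : ℝ≥0) (z : (N.generator C V).domain),
      (V s z, V s (N.generator C V z)) ∈ (N.generator C V).graph := fun s z =>
    hV.apply_mem_graph (LinearPMap.mem_graph _ z) s
  have hdom : ∀ s, ∀ z ∈ (N.generator C V).domain, V s z ∈ (N.generator C V).domain :=
    fun s z hz => LinearPMap.mem_domain_of_mem_graph (hg s ⟨z, hz⟩)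
  have hA : ∀ (s : ℝ≥0) (z : (N.generator C V).domain),
      N.generator C V ((V s).restrict (hdom s) z) = V s (N.generator C V z) := fun s z =>
    ((LinearPMap.image_iff (hdom s z z.2)).2 (hg s z)).symm
  refine ⟨hV.isMildExistenceFamily hVb hX, hdom, hV.bounded_C, fun l hl => ?_, fun z => ?_,
    fun z s => ?_⟩
  · obtain ⟨η, hη⟩ := hVb l hl
    refine ⟨η, fun s hs => ⟨(hη s hs).1, fun z => ?_⟩⟩
    change N (V s z) + N (N.generator C V ((V s).restrict (hdom s) z)) ≤
      η * (N (z : X) + N (N.generator C V z))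
    rw [hA, mul_add, ← AEEqFun.coeFn_le]
    filter_upwards [ae_le_mul (hη s hs) (z : X), ae_le_mul (hη s hs) (N.generator C V z),
      AEEqFun.coeFn_add (N (V s z)) (N (V s (N.generator C V z))),
      AEEqFun.coeFn_add (η * N (z : X)) (η * N (N.generator C V z))] with ω h1 h2 h3 h4
    rw [h3, h4]
    exact add_le_add h1 h2
  · rw [isCont_iff]
    intro s
    rw [tendsTo_graphNorm_iff]
    simp only [hA]
    exact ⟨N.isCont_iff.1 (hV.cont z) s, N.isCont_iff.1 (hV.cont (N.generator C V z)) s⟩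
  · simp only [hA]
    obtain ⟨η, hη⟩ := hVb.exists_mem_bounds (s + 1)
    exact (hV.orbit hVb hX (LinearPMap.mem_graph _ z) hη).1 s (by simp)

theorem HasRiemannIntegral.sub {f g : ℝ≥0 → X} {a b : ℝ≥0} {y z : X}
    (hf : N.HasRiemannIntegral f a b y) (hg : N.HasRiemannIntegral g a b z) :
    N.HasRiemannIntegral (fun u => f u - g u) a b (y - z) := by
  intro ε hε lam hlam
  have hl : (1 + lam) / 2 ∈ Set.Ioo (0 : ℝ) 1 := ⟨by linarith [hlam.1], by linarith [hlam.2]⟩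
  obtain ⟨d, hd, h1⟩ := hf (ε / 2) (by positivity) _ hl
  obtain ⟨d', hd', h2⟩ := hg (ε / 2) (by positivity) _ hl
  refine ⟨min d d', lt_min hd hd', fun n t τ h0 hn ht => ?_⟩
  have e1 := h1 n t τ h0 hn fun i hi => ⟨(ht i hi).1, (ht i hi).2.1,
    (ht i hi).2.2.trans_le (min_le_left _ _)⟩
  have e2 := h2 n t τ h0 hn fun i hi => ⟨(ht i hi).1, (ht i hi).2.1,
    (ht i hi).2.2.trans_le (min_le_right _ _)⟩
  have := N.add_mem_basicNhd e1
    (N.mem_basicNhd_of_ae_le e2 ((N.ae_neg _).mono fun ω h => h.le))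
  convert this using 1
  simp only [rsmul_sub, Finset.sum_sub_distrib]
  abel

/-- The order bound on `A (U u)` needed by `eq_zero_of_hasDeriv` is extracted from the Lipschitz
constant of `U`, because `A (U u)` is a limit of difference quotients. -/
theorem IsCSemigroup.solution_unique (hV : N.IsCSemigroup C V) (hVb : N.LocallyASBounded V)
    (hX : N.IsComplete) {A : X →ₗ.[Ω →ₘ[P] 𝕜] X} (hA : A ≤ N.generator C V) {z : X}
    {W₁ W₂ : ℝ≥0 → X} (h₁ : N.IsSolution A z W₁) (h₂ : N.IsSolution A z W₂)
    (hL₁ : N.LocallyL0Lipschitz W₁) (hL₂ : N.LocallyL0Lipschitz W₂) : W₁ = W₂ := by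
  funext l
  -- The longer interval supplies a neighbourhood for the difference quotients at `u = l`.
  obtain ⟨ξ, hξ⟩ := (hL₁.lipOn (l := l + 1) (by positivity)).sub
    (hL₂.lipOn (l := l + 1) (by positivity))
  have hl : l < l + 1 := by simp
  let U : ℝ≥0 → A.domain := fun u => ⟨W₁ u, h₁.mem_domain u⟩ - ⟨W₂ u, h₂.mem_domain u⟩
  have hder : ∀ u, 0 < u → N.HasDeriv (fun u => W₁ u - W₂ u) (A (U u)) u := by
    intro u hu
    rw [LinearPMap.map_sub]
    exact hasDeriv_sub (h₁.hasDeriv u hu) (h₂.hasDeriv u hu)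
  have hcont : N.TendsTo (fun u => A (U u)) (𝓝 0) (A (U 0)) := by
    simp only [U, LinearPMap.map_sub]
    exact (tendsTo_graphNorm_iff.1 ((isCont_iff _).1 h₁.cont 0)).2.sub
      (tendsTo_graphNorm_iff.1 ((isCont_iff _).1 h₂.cont 0)).2
  have hbpos : ∀ u, 0 < u → u < l + 1 → ∀ᵐ ω ∂P, (N (A (U u)) : Ω → ℝ) ω ≤ (ξ : Ω → ℝ) ω := by
    intro u hu hul
    refine TendsTo.ae_le (hder u hu) ?_
    have hlt : ∀ᶠ t in 𝓝[≠] u, t < l + 1 := nhdsWithin_le_nhds (Iio_mem_nhds hul)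
    filter_upwards [hlt, self_mem_nhdsWithin] with t ht htu
    have htu' : (t : ℝ) - u ≠ 0 := sub_ne_zero.2 (by exact_mod_cast htu)
    filter_upwards [hξ t ht.le u hul.le,
      N.ae_rsmul ((t : ℝ) - u)⁻¹ ((W₁ t - W₂ t) - (W₁ u - W₂ u))] with ω h3 h4
    rw [h4, abs_inv, inv_mul_le_iff₀ (abs_pos.2 htu')]
    exact h3
  have hb : ∀ u ≤ l, ∀ᵐ ω ∂P, (N (A (U u)) : Ω → ℝ) ω ≤ (ξ : Ω → ℝ) ω := by
    intro u hu
    rcases eq_or_ne u 0 with rfl | hu0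
    -- The equation is not imposed at time zero; continuity for the graph norm extends the bound to
    -- it.
    · have h3 : N.TendsTo (fun u => A (U u)) (𝓝[>] 0) (A (U 0)) :=
        Tendsto.mono_left hcont nhdsWithin_le_nhds
      refine h3.ae_le ?_
      filter_upwards [Ioo_mem_nhdsGT (show (0 : ℝ≥0) < l + 1 by positivity)] with v hv
      exact hbpos v hv.1 hv.2
    · exact hbpos u (pos_iff_ne_zero.2 hu0) (hu.trans_lt hl)
  refine sub_eq_zero.1 (hV.eq_zero_of_hasDeriv hVb hX (U := fun u => W₁ u - W₂ u)
    (B := fun u => A (U u)) (l := l) ?_ (fun u _ => ?_) ξ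
    (fun u hu v hv => hξ u (hu.trans hl.le) v (hv.trans hl.le)) hb fun u hu _ => hder u hu)
  · simp only [h₁.map_zero, h₂.map_zero, sub_self]
  · exact LinearPMap.le_graph_of_le hA (LinearPMap.mem_graph A (U u))

/-- The integral `U` of `W₁ - W₂` is Lipschitz by the order bound on mild solutions and solves `U' =
A U` with `U 0 = 0`. Once `U l = 0`, also `W₁ l - W₂ l = A (U l) = 0`. -/
theorem IsCSemigroup.mildSolution_unique (hV : N.IsCSemigroup C V) (hVb : N.LocallyASBounded V)
    (hX : N.IsComplete) {A : X →ₗ.[Ω →ₘ[P] 𝕜] X} (hA : A ≤ N.generator C V) {z : X}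
    {W₁ W₂ : ℝ≥0 → X} (h₁ : N.IsMildSolution A z W₁) (h₂ : N.IsMildSolution A z W₂) :
    W₁ = W₂ := by
  funext l
  obtain ⟨ξ₁, hξ₁⟩ := h₁.bddAbove l
  obtain ⟨ξ₂, hξ₂⟩ := h₂.bddAbove l
  have hb : ∀ u ≤ l, ∀ᵐ ω ∂P, (N (W₁ u - W₂ u) : Ω → ℝ) ω ≤ (ξ₁ + ξ₂ : Ω →ₘ[P] ℝ) ω := by
    intro u hu
    filter_upwards [N.ae_sub_le (W₁ u) (W₂ u),
      AEEqFun.coeFn_le.2 (hξ₁ (Set.mem_image_of_mem _ ⟨zero_le, hu⟩)),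
      AEEqFun.coeFn_le.2 (hξ₂ (Set.mem_image_of_mem _ ⟨zero_le, hu⟩)),
      AEEqFun.coeFn_add ξ₁ ξ₂] with ω h3 h4 h5 h6
    rw [h6, Pi.add_apply]
    linarith
  have hcont : N.IsCont fun u => W₁ u - W₂ u :=
    N.isCont_iff.2 fun u => (N.isCont_iff.1 h₁.cont u).sub (N.isCont_iff.1 h₂.cont u)
  obtain ⟨U, h0, hL, hd, hI⟩ := exists_primitive hX hcont (ξ₁ + ξ₂) hb
  have hgA : ∀ u ≤ l, (U u, W₁ u - W₂ u) ∈ A.graph := by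
    intro u hu
    obtain ⟨y₁, hy₁, e₁⟩ := h₁.integral u
    obtain ⟨y₂, hy₂, e₂⟩ := h₂.integral u
    have h3 := hI 0 u hu
    rw [h0, sub_zero] at h3
    -- Uniqueness of Riemann integrals identifies the constructed primitive with the integrals
    -- supplied by the two mild solutions.
    have h4 : U u = ((y₁ - y₂ : A.domain) : X) := h3.unique (hy₁.sub hy₂)
    have h5 : W₁ u - W₂ u = A (y₁ - y₂) := by
      rw [e₁, e₂, LinearPMap.map_sub]
      abel
    rw [h4, h5]
    exact LinearPMap.mem_graph A _
  have hU : U l = 0 := hV.eq_zero_of_hasDeriv hVb hX h0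
    (fun u hu => LinearPMap.le_graph_of_le hA (hgA u hu)) (ξ₁ + ξ₂) (fun u _ v _ => hL u v) hb
    fun u _ hul => hd u hul
  have h6 := hgA l le_rfl
  exact sub_eq_zero.1 (LinearPMap.graph_fst_eq_zero_snd A h6 hU)

end Semigroup

end L0Norm

theorem theorem5p2 {𝕜 : Type*} [RCLike 𝕜] {Ω : Type*} [MeasurableSpace Ω] (P : Measure Ω)
    [IsProbabilityMeasure P] {X : Type*} [AddCommGroup X] [Module (Ω →ₘ[P] 𝕜) X]
    (N : L0Norm 𝕜 P X) (hX : N.IsComplete) (C : X →ₗ[Ω →ₘ[P] 𝕜] X)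
    (V : ℝ≥0 → X →ₗ[Ω →ₘ[P] 𝕜] X) (hV : N.IsCSemigroup C V) (hVb : N.LocallyASBounded V) :
    N.IsStrongExistenceFamily (N.generator C V) C V ∧
    ∀ A : X →ₗ.[Ω →ₘ[P] 𝕜] X, A ≤ N.generator C V → ∀ z : X,
      (∀ W₁ W₂ : ℝ≥0 → X, N.IsSolution A z W₁ → N.IsSolution A z W₂ →
        N.LocallyL0Lipschitz W₁ → N.LocallyL0Lipschitz W₂ → W₁ = W₂) ∧
      (∀ W₁ W₂ : ℝ≥0 → X, N.IsMildSolution A z W₁ → N.IsMildSolution A z W₂ →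
        N.LocallyL0Lipschitz W₁ → N.LocallyL0Lipschitz W₂ → W₁ = W₂) :=
  ⟨hV.isStrongExistenceFamily hVb hX, fun _ hA _ =>
    ⟨fun _ _ h₁ h₂ hL₁ hL₂ => hV.solution_unique hVb hX hA h₁ h₂ hL₁ hL₂,
      fun _ _ h₁ h₂ _ _ => hV.mildSolution_unique hVb hX hA h₁ h₂⟩⟩
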